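/- Let $d\ge 1$. For bounded measurable $m:\mathbb{R}^{d}\times\mathbb{R}^d\to\mathbb{C}$ and $f,g\in C_c^\infty(\mathbb{R}^d)$ put $$T_m(f,g)(x)=\int_{\mathbb{R}^{2d}}\hat f(\xi)\hat g(\eta)m(\xi,\eta)e^{2\pi i x\cdot(\xi+\eta)}\,d\xi\,d\eta ,\qquad \hat f(\xi)=\int f(x)e^{-2\pi i x\cdot\xi}dx,$$ and for nonempty sets $E,E_1,E_2\subset[1,2]$ put $$\mathcal{A}_{m,E}(f,g)(x)=\sup_{t\in E}|T_{m(t\cdot,t\cdot)}(f,g)(x)|,\qquad \mathcal{A}^{(2)}_{m,E_1,E_2}(f,g)(x)=\sup_{t_1\in E_1,\,t_2\in E_2}|T_{m(t_1\cdot,t_2\cdot)}(f,g)(x)|.$$ We say that $m$ is $a$-admissible up to order $k$ if $a>d/2$, $m\in C^k(\mathbb{R}^{2d})$, and for every multi-index $\alpha$ with $|\alpha|\le k$ there is $C_\alpha$ with $|\partial^\alpha m(\xi,\eta)|\le C_\alpha(1+|\xi|+|\eta|)^{-a}$ for all $\xi,\eta\in\mathbb{R}^d$. The upper Minkowski dimension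 of $E$ is $\limsup_{\delta\to0^+}\log N(E,\delta)/\log(1/\delta)$, where $N(E,\delta)$ is the minimal number of closed intervals of length $\delta$ needed to cover $E$. We write $A:L^p\times L^q\to L^2$ if there is a constant $C$ with $\|A(f,g)\|_{L^2}\le C\|f\|_{L^p}\|g\|_{L^q}$ for all $f,g\in C_c^\infty(\mathbb{R}^d)$. (1) Let $E\subset[1,2]$ be nonempty with upper Minkowski dimension $\beta$, and let $m$ be $a$-admissible up to order $1$ with $2a>d+\beta$. If $2a\le 2d+\beta$, then $$\mathcal{A}_{m,E}:L^p\times L^q\to L^2\quad\text{whenever}\quad \frac{2d}{2a-\beta}<p,q\le 2,\quad \frac1p+\frac1q<\frac12+\frac{2a-\beta}{2d}.$$ If $2a>2d+\beta$, then $\mathcal{A}_{m,E}:L^p\times L^q\to L^2$ whenever $1<p,q\le2$ and $\frac1p+\frac1q<\frac32$. (2) Let $E_1,E_2\subset[1,2]$ be nonempty with upper Minkowski dimensions $\beta_1,\beta_2$, and let $m$ be $a$-admissible up to order $2$ with $2a>d+\beta_1+\beta_2$. If $2a\le 2d+\beta_1+\beta_2$, then $$\mathcal{A}^{(2)}_{m,E_1,E_2}:L^p\times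 L^q\to L^2\quad\text{whenever}\quad \frac{2d}{2a-\beta_1-\beta_2}<p,q\le 2,\quad \frac1p+\frac1q<\frac12+\frac{2a-\beta_1-\beta_2}{2d}.$$ If $2a>2d+\beta_1+\beta_2$, then $\mathcal{A}^{(2)}_{m,E_1,E_2}:L^p\times L^q\to L^2$ whenever $1<p,q\le2$ and $\frac1p+\frac1q<\frac32$. -/

import Mathlib

open MeasureTheory Filter Topology Set
open scoped ENNReal NNReal ContDiff FourierTransform RealInnerProductSpace

noncomputable section

/-- `N(E, δ)`: the minimal number of closed intervals of length `δ` needed to cover `E ⊆ ℝ`. -/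
def intervalCoveringNumber (E : Set ℝ) (δ : ℝ) : ℕ :=
  sInf {n : ℕ | ∃ c : Finset ℝ, c.card = n ∧ E ⊆ ⋃ x ∈ c, Icc x (x + δ)}

/-- The upper Minkowski dimension `limsup_{δ → 0+} log N(E, δ) / log (1 / δ)` of a (nonempty,
bounded) set `E ⊆ ℝ`. For such sets the quotient is nonnegative and bounded for small `δ`, so the
real-valued `limsup` is the genuine one. -/
def upperMinkowskiDim (E : Set ℝ) : ℝ :=
  limsup (fun δ : ℝ => Real.log (intervalCoveringNumber E δ) / Real.log (1 / δ)) (𝓝[>] (0 : ℝ))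

/-- `m` is an `a`-admissible bilinear multiplier on `ℝ^d × ℝ^d` up to order `k`: it is of class
`C^k`, `a > d / 2`, and all derivatives of order at most `k` are
`O((1 + |ξ| + |η|)^(-a))`. The norm of the `j`-th derivative (a `j`-linear form) is comparable to
the maximum of the absolute values of the partial derivatives `∂^α m` with `|α| = j`. -/
structure IsAdmissibleMultiplier {d : ℕ}
    (m : EuclideanSpace ℝ (Fin d) × EuclideanSpace ℝ (Fin d) → ℂ) (a : ℝ) (k : ℕ) : Prop where
  contDiff : ContDiff ℝ k m
  half_dim_lt : (d : ℝ) / 2 < a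
  decay : ∀ j : ℕ, j ≤ k → ∃ C : ℝ, ∀ ξ η : EuclideanSpace ℝ (Fin d),
    ‖iteratedFDeriv ℝ j m (ξ, η)‖ ≤ C / (1 + ‖ξ‖ + ‖η‖) ^ a

/-- The bilinear multiplier operator
`T_m(f,g)(x) = ∫ f̂(ξ) ĝ(η) m(ξ,η) exp(2πi x·(ξ+η)) dξ dη`, where
`f̂(ξ) = ∫ f(x) exp(-2πi x·ξ) dx`. -/
def bilinearMultiplier {d : ℕ}
    (m : EuclideanSpace ℝ (Fin d) × EuclideanSpace ℝ (Fin d) → ℂ)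
    (f g : EuclideanSpace ℝ (Fin d) → ℂ) (x : EuclideanSpace ℝ (Fin d)) : ℂ :=
  ∫ z : EuclideanSpace ℝ (Fin d) × EuclideanSpace ℝ (Fin d),
    𝓕 f z.1 * 𝓕 g z.2 * m z *
      Complex.exp (2 * (Real.pi : ℂ) * Complex.I * ((⟪x, z.1 + z.2⟫ : ℝ) : ℂ))

/-- The biparameter single-scale maximal operator
`A⁽²⁾_{m,E₁,E₂}(f,g)(x) = sup_{t₁ ∈ E₁, t₂ ∈ E₂} |T_{m(t₁ ·, t₂ ·)}(f,g)(x)|`. -/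
def biparameterMaximal {d : ℕ}
    (m : EuclideanSpace ℝ (Fin d) × EuclideanSpace ℝ (Fin d) → ℂ) (E₁ E₂ : Set ℝ)
    (f g : EuclideanSpace ℝ (Fin d) → ℂ) (x : EuclideanSpace ℝ (Fin d)) : ℝ≥0∞ :=
  ⨆ t₁ ∈ E₁, ⨆ t₂ ∈ E₂, ‖bilinearMultiplier (fun z => m (t₁ • z.1, t₂ • z.2)) f g x‖ₑ

/-- The single-scale maximal operator `A_{m,E}(f,g)(x) = sup_{t ∈ E} |T_{m(t ·, t ·)}(f,g)(x)|`. -/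
def singleScaleMaximal {d : ℕ}
    (m : EuclideanSpace ℝ (Fin d) × EuclideanSpace ℝ (Fin d) → ℂ) (E : Set ℝ)
    (f g : EuclideanSpace ℝ (Fin d) → ℂ) (x : EuclideanSpace ℝ (Fin d)) : ℝ≥0∞ :=
  ⨆ t ∈ E, ‖bilinearMultiplier (fun z => m (t • z.1, t • z.2)) f g x‖ₑ

/-- `A : L^p × L^q → L^r` for an operator `A` defined on pairs of test functions: for all
`f, g ∈ C_c^∞(ℝ^d)` the function `A(f,g)` is measurable and
`‖A(f,g)‖_r ≤ C ‖f‖_p ‖g‖_q`, with `C` independent of `f` and `g`. -/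
def BoundedOnLebesgue {d : ℕ}
    (A : (EuclideanSpace ℝ (Fin d) → ℂ) → (EuclideanSpace ℝ (Fin d) → ℂ) →
      EuclideanSpace ℝ (Fin d) → ℝ≥0∞) (p q r : ℝ) : Prop :=
  ∃ C : ℝ≥0, ∀ f g : EuclideanSpace ℝ (Fin d) → ℂ,
    ContDiff ℝ ∞ f → HasCompactSupport f → ContDiff ℝ ∞ g → HasCompactSupport g →
      Measurable (A f g) ∧
      eLpNorm (A f g) (ENNReal.ofReal r) volume ≤
        C * eLpNorm f (ENNReal.ofReal p) volume * eLpNorm g (ENNReal.ofReal q) volume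

end

/-! Only `L^2` orthogonality and a count of dilations are needed. Cut frequency space sharply into
shells `1 + |ξ| + |η| ~ 2^j`. For a fixed multiplier of size `2^(-ja)` on one shell, the change of
variables `ζ = ξ + η` shows the operator as a Fourier transform of fibre integrals. Plancherel, then
Cauchy–Schwarz on fibres of volume `≲ 2^(jd)`, reduce matters to `∫ |f̂|²` and `∫ |ĝ|²` over balls
of radius `~ 2^j`. Bernstein bounds these by `2^(jd(2/p-1)) ‖f‖_p²` and `2^(jd(2/q-1)) ‖g‖_q²`.
Hence the squared `L^2` norm is `≲ 2^(js) ‖f‖_p² ‖g‖_q²` with `s = d(2/p + 2/q - 1) - 2a`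
(`lintegral_bilinearMultiplier_sq_le`).

For the supremum, cover `E` by `≲ 2^(γj)` intervals of length `2^(-j)`, with `γ > β`. On each
interval the fundamental theorem of calculus dominates the supremum by the value at an endpoint plus
an integral of the `t`-derivative. The derivative costs `2^j`, which the interval length repays
(`enorm_bilinearMultiplier_indicator_le`, `exists_shell_average_bound`). Replacing the maximum over
intervals by an `ℓ²` sum multiplies the squared norm by their number, so the shells sum when `γ + s
< 0` (`boundedOnLebesgue_of_cells`). Some `γ > β` satisfies this exactly when `1/p + 1/q < 1/2 + (2a
- β)/(2d)`. With two parameters, rectangles replace intervals and `β₁ + β₂` replaces `β`. -/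

/-! ### Plancherel and Bernstein inequalities from Gaussian weights. -/

section GaussianBound

variable {V : Type*} [NormedAddCommGroup V] [InnerProductSpace ℝ V] [FiniteDimensional ℝ V]
  [MeasurableSpace V] [BorelSpace V]

/-- Cauchy–Schwarz for lower Lebesgue integrals. -/
theorem lintegral_mul_sq_le {α : Type*} [MeasurableSpace α] {μ : Measure α} {f g : α → ℝ≥0∞}
    (hf : AEMeasurable f μ) (hg : AEMeasurable g μ) :
    (∫⁻ x, f x * g x ∂μ) ^ 2 ≤ (∫⁻ x, f x ^ 2 ∂μ) * ∫⁻ x, g x ^ 2 ∂μ := by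
  have h := ENNReal.lintegral_mul_le_Lp_mul_Lq μ Real.HolderConjugate.two_two hf hg
  simp only [Pi.mul_apply, ENNReal.rpow_two] at h
  calc _ ≤ _ := pow_le_pow_left' h 2
    _ = _ := by
      rw [mul_pow, ← ENNReal.rpow_two, ← ENNReal.rpow_two, ← ENNReal.rpow_mul, ← ENNReal.rpow_mul]
      norm_num

/-- Young's inequality for the quadratic form of a bounded kernel with integrable rows. -/
theorem lintegral_kernel_le {α : Type*} [MeasurableSpace α] {μ : Measure α} [SFinite μ]
    {F : α → ℝ≥0∞} (hF : AEMeasurable F μ) {K : α → α → ℝ≥0∞}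
    (hK : Measurable (Function.uncurry K)) (hsymm : ∀ x y, K x y = K y x) {M : ℝ≥0∞}
    (hM : ∀ x y, K x y ≤ M) (h1 : ∀ x, ∫⁻ y, K x y ∂μ ≤ 1) {p : ℝ} (hp : 1 ≤ p) (hp2 : p ≤ 2) :
    ∫⁻ x, F x * ∫⁻ y, F y * K x y ∂μ ∂μ ≤ M ^ (2 / p - 1) * (∫⁻ x, F x ^ p ∂μ) ^ (2 / p) := by
  have hp0 : 0 < p := by linarith
  -- Exponents for a three-factor Hölder inequality with factors `F(x)^p F(y)^p K`, `F(x)^p K` and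
  -- `F(y)^p K`. The relations `θ + 2l = 1` and `p(θ + l) = 1` recover `F(x) F(y) K`; `p ≤ 2` gives
  -- `θ ≥ 0` and `1 ≤ p` gives `l ≥ 0`.
  set θ := 2 / p - 1 with hθ
  set l := 1 - 1 / p with hl
  have hθ0 : 0 ≤ θ := by rw [hθ, sub_nonneg, le_div_iff₀ hp0]; linarith
  have hl0 : 0 ≤ l := by rw [hl, sub_nonneg, div_le_iff₀ hp0]; linarith
  have hsum : θ + l + l = 1 := by rw [hθ, hl]; ring
  have hpow : p * θ + p * l = 1 := by rw [hθ, hl]; field_simp; ring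
  have hFp : AEMeasurable (fun x => F x ^ p) μ := hF.pow_const p
  have hF1 : AEMeasurable (fun z : α × α => F z.1) (μ.prod μ) := hF.comp_fst
  have hF2 : AEMeasurable (fun z : α × α => F z.2) (μ.prod μ) := hF.comp_snd
  have hK' : AEMeasurable (fun z : α × α => K z.1 z.2) (μ.prod μ) := hK.aemeasurable
  set I := ∫⁻ x, F x ^ p ∂μ with hI
  let G : Fin 3 → α × α → ℝ≥0∞ := ![fun z => F z.1 ^ p * F z.2 ^ p * K z.1 z.2,
    fun z => F z.1 ^ p * K z.1 z.2, fun z => F z.2 ^ p * K z.1 z.2]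
  let w : Fin 3 → ℝ := ![θ, l, l]
  have hG : ∀ i ∈ Finset.univ, AEMeasurable (G i) (μ.prod μ) := by
    intro i _
    fin_cases i
    · exact ((hF1.pow_const p).mul (hF2.pow_const p)).mul hK'
    · exact (hF1.pow_const p).mul hK'
    · exact (hF2.pow_const p).mul hK'
  have key := ENNReal.lintegral_prod_norm_pow_le (μ := μ.prod μ) Finset.univ (f := G) hG (p := w)
    (by simp [w, Fin.sum_univ_three, hsum]) (by intro i _; fin_cases i <;> simp [w, hθ0, hl0])
  simp only [Fin.prod_univ_three] at key
  -- The height `M` of the kernel is spent only here; the other two factors use its row masses.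
  have e0 : ∫⁻ z, G 0 z ∂(μ.prod μ) ≤ M * I ^ 2 := by
    calc ∫⁻ z, G 0 z ∂(μ.prod μ) ≤ ∫⁻ z : α × α, F z.1 ^ p * F z.2 ^ p * M ∂(μ.prod μ) := by
          refine lintegral_mono fun z => ?_
          exact mul_le_mul_right (hM _ _) _
      _ = M * I ^ 2 := by
          have h := lintegral_mul_const'' (μ := μ.prod μ) (f := fun z => F z.1 ^ p * F z.2 ^ p) M
            ((hF1.pow_const p).mul (hF2.pow_const p))
          rw [h, lintegral_prod_mul hFp hFp]
          ring
  have e1 : ∫⁻ z, G 1 z ∂(μ.prod μ) ≤ I := by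
    calc ∫⁻ z, G 1 z ∂(μ.prod μ) = ∫⁻ x, F x ^ p * ∫⁻ y, K x y ∂μ ∂μ := by
          rw [lintegral_prod _ (hG 1 (Finset.mem_univ _))]
          refine lintegral_congr fun x => ?_
          exact lintegral_const_mul (F x ^ p) (f := fun y => K x y) hK.of_uncurry_left
      _ ≤ I := lintegral_mono fun x => mul_le_of_le_one_right' (h1 x)
  have e2 : ∫⁻ z, G 2 z ∂(μ.prod μ) ≤ I := by
    calc ∫⁻ z, G 2 z ∂(μ.prod μ) = ∫⁻ x, F x ^ p * ∫⁻ y, K x y ∂μ ∂μ := by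
          rw [lintegral_prod_symm _ (hG 2 (Finset.mem_univ _))]
          refine lintegral_congr fun x => ?_
          simp_rw [hsymm x]
          exact lintegral_const_mul (F x ^ p) (f := fun y => K y x) hK.of_uncurry_right
      _ ≤ I := lintegral_mono fun x => mul_le_of_le_one_right' (h1 x)
  have e3 : ∫⁻ x, F x * ∫⁻ y, F y * K x y ∂μ ∂μ =
      ∫⁻ z, F z.1 * (F z.2 * K z.1 z.2) ∂(μ.prod μ) := by
    have h := lintegral_prod (μ := μ) (ν := μ) (fun z => F z.1 * (F z.2 * K z.1 z.2))
      (hF1.mul (hF2.mul hK'))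
    rw [h]
    refine lintegral_congr fun x => ?_
    exact (lintegral_const_mul'' (F x) (f := fun y => F y * K x y)
      (hF.mul hK.of_uncurry_left.aemeasurable)).symm
  rw [e3]
  calc _ = ∫⁻ z, G 0 z ^ w 0 * G 1 z ^ w 1 * G 2 z ^ w 2 ∂(μ.prod μ) := by
        refine lintegral_congr fun z => ?_
        have aux : ∀ c : ℝ≥0∞, c = (c ^ p) ^ θ * (c ^ p) ^ l := by
          intro c
          rw [← ENNReal.rpow_mul, ← ENNReal.rpow_mul,
            ← ENNReal.rpow_add_of_nonneg _ _ (by positivity) (by positivity), hpow,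
            ENNReal.rpow_one]
        have auxK : ∀ c : ℝ≥0∞, c = c ^ θ * c ^ l * c ^ l := by
          intro c
          rw [← ENNReal.rpow_add_of_nonneg _ _ hθ0 hl0,
            ← ENNReal.rpow_add_of_nonneg _ _ (by positivity) hl0, hsum, ENNReal.rpow_one]
        simp only [G, w, Matrix.cons_val_zero, Matrix.cons_val_one, Matrix.cons_val]
        rw [ENNReal.mul_rpow_of_nonneg _ _ hθ0, ENNReal.mul_rpow_of_nonneg _ _ hθ0,
          ENNReal.mul_rpow_of_nonneg _ _ hl0, ENNReal.mul_rpow_of_nonneg _ _ hl0]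
        conv_lhs => rw [aux (F z.1), aux (F z.2), auxK (K z.1 z.2)]
        ring
    _ ≤ _ := key
    _ ≤ (M * I ^ 2) ^ θ * I ^ l * I ^ l := by
        simp only [w, Matrix.cons_val_zero, Matrix.cons_val_one, Matrix.cons_val]
        gcongr
    _ = _ := by
        rw [ENNReal.mul_rpow_of_nonneg _ _ hθ0, ← ENNReal.rpow_two, ← ENNReal.rpow_mul, mul_assoc,
          mul_assoc, ← ENNReal.rpow_add_of_nonneg _ _ hl0 hl0,
          ← ENNReal.rpow_add_of_nonneg _ _ (by positivity) (by positivity)]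
        congr 2
        rw [hθ, hl]; ring

/-- The multiplication formula `∫ f̂ g = ∫ f ĝ`, used twice, turns a Gaussian-weighted norm of `𝓕 h`
into a quadratic form in `h` with an explicit Gaussian kernel, to which Young's inequality applies.
-/
theorem integral_fourier_mul_conj_gaussian {h : V → ℂ} (hh : Integrable h) {b : ℝ} (hb : 0 < b) :
    ∫ x, 𝓕 h x * (starRingEnd ℂ (𝓕 h x) * Complex.exp (-b * ‖x‖ ^ 2)) =
      ∫ y, h y * starRingEnd ℂ (∫ y', h y' * ((Real.pi / b : ℂ) ^ (Module.finrank ℝ V / 2 : ℂ) *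
        Complex.exp (-Real.pi ^ 2 * ‖y - y'‖ ^ 2 / b))) := by
  have hL : Continuous fun p : V × V => (innerₗ V) p.1 p.2 := continuous_inner
  have swap : ∀ {f g : V → ℂ}, Integrable f → Integrable g →
      ∫ ξ, 𝓕 f ξ * g ξ = ∫ x, f x * 𝓕 g x := by
    intro f g hf hg
    have := VectorFourier.integral_fourierIntegral_smul_eq_flip (L := innerₗ V) (μ := volume)
      (ν := volume) Real.continuous_fourierChar hL hf hg
    simpa [flip_innerₗ] using! this
  have hc : Continuous (𝓕 h) :=
    VectorFourier.fourierIntegral_continuous Real.continuous_fourierChar hL hh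
  have hbd : ∀ x, ‖𝓕 h x‖ ≤ ∫ y, ‖h y‖ := fun x =>
    VectorFourier.norm_fourierIntegral_le_integral_norm _ _ _ _ _
  have hγ : ∀ y : V, Integrable
      (fun v : V => Complex.exp (-b * ‖v‖ ^ 2 + 2 * Real.pi * Complex.I * ⟪y, v⟫)) := by
    intro y
    simpa using GaussianFourier.integrable_cexp_neg_mul_sq_norm_add (V := V) (b := b)
      (by simpa using hb) (2 * Real.pi * Complex.I) y
  have hγ0 : Integrable (fun v : V => Complex.exp (-b * ‖v‖ ^ 2)) := by simpa using hγ 0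
  rw [swap hh]
  · refine integral_congr_ae (ae_of_all _ fun y => ?_)
    simp only
    congr 1
    -- Second use, against a modulated Gaussian: it evaluates, up to conjugation, the transform of
    -- `conj (𝓕 h)` times the Gaussian at `y`.
    have e := swap hh (hγ y)
    simp only [fourier_gaussian_innerProductSpace' (b := (b : ℂ)) (by simpa using hb)] at e
    rw [← e, ← integral_conj, Real.fourier_eq']
    refine integral_congr_ae (ae_of_all _ fun v => ?_)
    simp only [smul_eq_mul, map_mul, ← Complex.exp_conj, map_neg, map_pow,
      Complex.conj_ofReal, Complex.conj_I, Complex.exp_add, map_ofNat]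
    rw [real_inner_comm v y]
    push_cast
    ring_nf
  · refine hγ0.bdd_mul (c := ∫ y, ‖h y‖) (Continuous.aestronglyMeasurable (by fun_prop)) ?_
    exact ae_of_all _ fun x => by simpa using hbd x

theorem integrable_rexp_neg_mul_sq_norm {b : ℝ} (hb : 0 < b) :
    Integrable fun x : V => Real.exp (-b * ‖x‖ ^ 2) := by
  have := GaussianFourier.integrable_cexp_neg_mul_sq_norm_add (V := V) (b := (b : ℂ))
    (by rwa [Complex.ofReal_re]) 0 0
  refine this.re.congr (ae_of_all _ fun v => ?_)
  simp only [zero_mul, add_zero]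
  rw [← Complex.exp_ofReal_re]
  push_cast
  rfl

theorem fourier_continuous {h : V → ℂ} (hh : Integrable h) : Continuous (𝓕 h) :=
  VectorFourier.fourierIntegral_continuous Real.continuous_fourierChar continuous_inner hh

theorem lintegral_gaussian_kernel (R : ℝ) (hR : 0 < R) (x : V) :
    ∫⁻ y : V, ENNReal.ofReal (R ^ Module.finrank ℝ V *
      Real.exp (-(Real.pi * R ^ 2) * ‖x - y‖ ^ 2)) = 1 := by
  have hb : 0 < Real.pi * R ^ 2 := by positivity
  rw [lintegral_sub_left_eq_self (fun v : V => ENNReal.ofReal (R ^ Module.finrank ℝ V *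
      Real.exp (-(Real.pi * R ^ 2) * ‖v‖ ^ 2))) x,
    ← ofReal_integral_eq_lintegral_ofReal]
  · rw [integral_const_mul, GaussianFourier.integral_rexp_neg_mul_sq_norm hb,
      div_mul_cancel_left₀ Real.pi_ne_zero, ← Real.rpow_natCast, ← Real.rpow_neg_one,
      ← Real.rpow_natCast R 2, ← Real.rpow_mul hR.le, ← Real.rpow_mul hR.le, ← Real.rpow_add hR]
    rw [show ((Module.finrank ℝ V : ℕ) : ℝ) + ((2 : ℕ) : ℝ) * -1 * ((Module.finrank ℝ V : ℕ) / 2)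
      = 0 by push_cast; ring]
    simp
  · exact (integrable_rexp_neg_mul_sq_norm hb).const_mul _
  · exact ae_of_all _ fun v => by positivity

/-- Gaussian-weighted `L^p → L^2` bound for the Fourier transform, `1 ≤ p ≤ 2`. -/
theorem lintegral_fourier_sq_gaussian_le {h : V → ℂ} (hh : Integrable h) {R : ℝ} (hR : 0 < R)
    {p : ℝ} (hp : 1 ≤ p) (hp2 : p ≤ 2) :
    ∫⁻ x, ‖𝓕 h x‖ₑ ^ 2 * ENNReal.ofReal (Real.exp (-(Real.pi / R ^ 2) * ‖x‖ ^ 2)) ≤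
      ENNReal.ofReal (R ^ Module.finrank ℝ V) ^ (2 / p - 1) *
        (∫⁻ x, ‖h x‖ₑ ^ p) ^ (2 / p) := by
  set K : V → V → ℝ := fun x y => R ^ Module.finrank ℝ V *
      Real.exp (-(Real.pi * R ^ 2) * ‖x - y‖ ^ 2) with hK
  have hKc : Continuous (Function.uncurry K) := by
    simp only [hK, Function.uncurry_def]; fun_prop
  have hb : 0 < Real.pi / R ^ 2 := by positivity
  have hbd : ∀ x, ‖𝓕 h x‖ ≤ ∫ y, ‖h y‖ := fun x =>
    VectorFourier.norm_fourierIntegral_le_integral_norm _ _ _ _ _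
  -- The choice `b = π / R²` gives a kernel of total mass one and height `R^n`, where `n = dim V`.
  have hKeq : ∀ y y' : V, ((Real.pi / (Real.pi / R ^ 2 : ℝ) : ℂ) ^ (Module.finrank ℝ V / 2 : ℂ) *
        Complex.exp (-Real.pi ^ 2 * ‖y - y'‖ ^ 2 / (Real.pi / R ^ 2 : ℝ))) = (K y y' : ℂ) := by
    intro y y'
    have h1 : (Real.pi / (Real.pi / R ^ 2 : ℝ) : ℂ) = ((R ^ 2 : ℝ) : ℂ) := by
      rw [← Complex.ofReal_div]; congr 1; field_simp
    have h2 : (Module.finrank ℝ V / 2 : ℂ) = (((Module.finrank ℝ V : ℝ) / 2 : ℝ) : ℂ) := by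
      push_cast; rfl
    rw [h1, h2, ← Complex.ofReal_cpow (by positivity), hK]
    push_cast
    congr 2
    · rw [← Real.rpow_natCast R 2, ← Real.rpow_mul hR.le, ← Complex.ofReal_pow,
        ← Real.rpow_natCast]
      congr 2
      push_cast; ring
    · have : (R : ℂ) ≠ 0 := by exact_mod_cast hR.ne'
      field_simp
  have id := integral_fourier_mul_conj_gaussian hh hb
  simp only [hKeq] at id
  have hint : Integrable fun x : V => ‖𝓕 h x‖ ^ 2 * Real.exp (-(Real.pi / R ^ 2) * ‖x‖ ^ 2) := by
    have hγ := integrable_rexp_neg_mul_sq_norm (V := V) hb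
    refine hγ.bdd_mul (c := (∫ y, ‖h y‖) ^ 2)
      (((fourier_continuous hh).norm.pow 2).aestronglyMeasurable) ?_
    refine ae_of_all _ fun x => ?_
    rw [norm_pow, norm_norm]
    exact pow_le_pow_left₀ (norm_nonneg _) (hbd x) 2
  have hlhs : ∫⁻ x, ‖𝓕 h x‖ₑ ^ 2 * ENNReal.ofReal (Real.exp (-(Real.pi / R ^ 2) * ‖x‖ ^ 2)) =
      ‖∫ x, 𝓕 h x * (starRingEnd ℂ (𝓕 h x) *
        Complex.exp (-(Real.pi / R ^ 2 : ℝ) * ‖x‖ ^ 2))‖ₑ := by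
    have h1 : ∀ x, 𝓕 h x * (starRingEnd ℂ (𝓕 h x) *
        Complex.exp (-(Real.pi / R ^ 2 : ℝ) * ‖x‖ ^ 2)) =
        ((‖𝓕 h x‖ ^ 2 * Real.exp (-(Real.pi / R ^ 2) * ‖x‖ ^ 2) : ℝ) : ℂ) := by
      intro x
      rw [← mul_assoc, Complex.mul_conj, Complex.normSq_eq_norm_sq]
      push_cast
      rfl
    simp_rw [h1]
    rw [integral_complex_ofReal, ← ofReal_norm, Complex.norm_real, Real.norm_of_nonneg
      (integral_nonneg fun x => by positivity), ofReal_integral_eq_lintegral_ofReal hint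
      (ae_of_all _ fun x => by positivity)]
    refine lintegral_congr fun x => ?_
    rw [ENNReal.ofReal_mul (by positivity), ENNReal.ofReal_pow (norm_nonneg _), ofReal_norm]
  rw [hlhs, id]
  calc _ ≤ ∫⁻ y, ‖h y * starRingEnd ℂ (∫ y', h y' * (K y y' : ℂ))‖ₑ :=
        enorm_integral_le_lintegral_enorm _
    _ ≤ ∫⁻ y, ‖h y‖ₑ * ∫⁻ y', ‖h y'‖ₑ * ENNReal.ofReal (K y y') := by
        refine lintegral_mono fun y => ?_
        simp only [enorm_mul]
        gcongr
        rw [← ofReal_norm, RCLike.norm_conj, ofReal_norm]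
        refine (enorm_integral_le_lintegral_enorm _).trans (lintegral_mono fun y' => ?_)
        rw [enorm_mul, ← ofReal_norm (K y y' : ℂ), Complex.norm_real, Real.norm_of_nonneg]
        simp only [hK]; positivity
    _ ≤ _ := by
        refine lintegral_kernel_le (K := fun y y' => ENNReal.ofReal (K y y')) hh.1.enorm ?_ ?_ ?_ ?_
          hp hp2
        · exact ENNReal.measurable_ofReal.comp hKc.measurable
        · intro x y; simp only [hK, norm_sub_rev]
        · intro x y
          refine ENNReal.ofReal_le_ofReal ?_
          simp only [hK]
          refine mul_le_of_le_one_right (by positivity) (Real.exp_le_one_iff.2 ?_)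
          have : 0 ≤ Real.pi * R ^ 2 * ‖x - y‖ ^ 2 := by positivity
          linarith
        · intro x
          exact (lintegral_gaussian_kernel R hR x).le

/-- Plancherel's inequality for integrable functions. -/
theorem lintegral_fourier_sq_le {h : V → ℂ} (hh : Integrable h) :
    ∫⁻ x, ‖𝓕 h x‖ₑ ^ 2 ≤ ∫⁻ x, ‖h x‖ₑ ^ 2 := by
  have hc := fourier_continuous hh
  -- At `p = 2` the power of `R` is zero, so the bound is uniform as the weight tends to one, and
  -- Fatou's lemma finishes.
  have key : ∀ n : ℕ, ∫⁻ x, ‖𝓕 h x‖ₑ ^ 2 * ENNReal.ofReal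
      (Real.exp (-(Real.pi / ((n : ℝ) + 1) ^ 2) * ‖x‖ ^ 2)) ≤ ∫⁻ x, ‖h x‖ₑ ^ 2 := by
    intro n
    have := lintegral_fourier_sq_gaussian_le hh (R := (n : ℝ) + 1) (by positivity) (p := 2)
      (by norm_num) le_rfl
    simpa using this
  have hlim : ∀ x : V, Tendsto (fun n : ℕ => ‖𝓕 h x‖ₑ ^ 2 * ENNReal.ofReal
      (Real.exp (-(Real.pi / ((n : ℝ) + 1) ^ 2) * ‖x‖ ^ 2))) atTop (𝓝 (‖𝓕 h x‖ₑ ^ 2)) := by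
    intro x
    have h1 : Tendsto (fun n : ℕ => (n : ℝ) + 1) atTop atTop :=
      tendsto_atTop_add_const_right _ _ tendsto_natCast_atTop_atTop
    have h2 : Tendsto (fun n : ℕ => -(Real.pi / ((n : ℝ) + 1) ^ 2) * ‖x‖ ^ 2) atTop (𝓝 0) := by
      have := (((tendsto_pow_atTop (two_ne_zero)).comp h1).const_div_atTop Real.pi).neg.mul_const
        (‖x‖ ^ 2)
      simpa using! this
    have h3 := (ENNReal.continuous_ofReal.tendsto _).comp ((Real.continuous_exp.tendsto _).comp h2)
    have h4 := ENNReal.Tendsto.const_mul (a := ‖𝓕 h x‖ₑ ^ 2) h3 (Or.inr (by simp))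
    simpa using! h4
  calc ∫⁻ x, ‖𝓕 h x‖ₑ ^ 2 = ∫⁻ x, liminf (fun n : ℕ => ‖𝓕 h x‖ₑ ^ 2 * ENNReal.ofReal
      (Real.exp (-(Real.pi / ((n : ℝ) + 1) ^ 2) * ‖x‖ ^ 2))) atTop :=
        lintegral_congr fun x => (hlim x).liminf_eq.symm
    _ ≤ liminf (fun n : ℕ => ∫⁻ x, ‖𝓕 h x‖ₑ ^ 2 * ENNReal.ofReal
      (Real.exp (-(Real.pi / ((n : ℝ) + 1) ^ 2) * ‖x‖ ^ 2))) atTop := by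
        refine lintegral_liminf_le fun n => ?_
        have h1 : Measurable fun x => ‖𝓕 h x‖ₑ := hc.enorm.measurable
        fun_prop
    _ ≤ _ := liminf_le_of_le (by isBoundedDefault) fun b hb => by
        obtain ⟨n, hn⟩ := hb.exists
        exact hn.trans (key n)

/-- Bernstein's inequality `L^p → L^2`, on the Fourier side. -/
theorem lintegral_closedBall_fourier_sq_le {h : V → ℂ} (hh : Integrable h) {R : ℝ} (hR : 0 < R)
    {p : ℝ} (hp : 1 ≤ p) (hp2 : p ≤ 2) :
    ∫⁻ x in Metric.closedBall 0 R, ‖𝓕 h x‖ₑ ^ 2 ≤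
      ENNReal.ofReal (Real.exp Real.pi) * (ENNReal.ofReal (R ^ Module.finrank ℝ V) ^ (2 / p - 1) *
        (∫⁻ x, ‖h x‖ₑ ^ p) ^ (2 / p)) := by
  -- The Gaussian weight is at least `e^(-π)` on the ball of radius `R`.
  calc _ ≤ ∫⁻ x in Metric.closedBall 0 R, ENNReal.ofReal (Real.exp Real.pi) * (‖𝓕 h x‖ₑ ^ 2 *
      ENNReal.ofReal (Real.exp (-(Real.pi / R ^ 2) * ‖x‖ ^ 2))) := by
        refine setLIntegral_mono' Metric.isClosed_closedBall.measurableSet fun x hx => ?_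
        rw [mul_left_comm, ← ENNReal.ofReal_mul (by positivity), ← Real.exp_add]
        refine le_mul_of_one_le_right' ?_
        rw [ENNReal.one_le_ofReal, Real.one_le_exp_iff]
        have hx' : ‖x‖ ≤ R := by simpa using hx
        have h1 : ‖x‖ ^ 2 / R ^ 2 ≤ 1 := by
          rw [div_le_one (by positivity)]; gcongr
        have h2 : -(Real.pi / R ^ 2) * ‖x‖ ^ 2 = - (Real.pi * (‖x‖ ^ 2 / R ^ 2)) := by ring
        rw [h2]
        nlinarith [Real.pi_pos]
    _ ≤ ∫⁻ x, ENNReal.ofReal (Real.exp Real.pi) * (‖𝓕 h x‖ₑ ^ 2 *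
      ENNReal.ofReal (Real.exp (-(Real.pi / R ^ 2) * ‖x‖ ^ 2))) := setLIntegral_le_lintegral _ _
    _ ≤ _ := by
        rw [lintegral_const_mul' _ _ ENNReal.ofReal_ne_top]
        gcongr
        exact lintegral_fourier_sq_gaussian_le hh hR hp hp2

end GaussianBound

/-! ### Fixed-time `L^2` estimates for localized multipliers. -/

section BilinearL2

variable {d : ℕ}

local notation "V" => EuclideanSpace ℝ (Fin d)

/-- The phase depends only on `ζ = ξ + η`, so a measure-preserving shear and Fubini leave a linear
Fourier transform in `ζ`, ready for Plancherel. -/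
theorem integral_mul_exp_inner_add {H : V × V → ℂ} (hH : Integrable H) (x : V) :
    ∫ z, H z * Complex.exp (2 * (Real.pi : ℂ) * Complex.I * ((⟪x, z.1 + z.2⟫ : ℝ) : ℂ)) =
      𝓕 (fun ζ : V => ∫ ξ, H (ξ, -ξ + ζ)) (-x) := by
  have hmp := measurePreserving_prod_neg_add (volume : Measure V) (volume : Measure V)
  have hmp' : MeasurePreserving (fun z : V × V => (z.1, -z.1 + z.2)) volume volume := hmp
  set e : V × V → ℂ := fun w =>
    Complex.exp (2 * (Real.pi : ℂ) * Complex.I * ((⟪x, w.2⟫ : ℝ) : ℂ)) with he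
  have hec : Continuous e := by simp only [he]; fun_prop
  have hen : ∀ w, ‖e w‖ = 1 := by
    intro w
    have := Complex.norm_exp_ofReal_mul_I (2 * Real.pi * ⟪x, w.2⟫)
    rw [← this]; simp only [he]; congr 2; push_cast; ring
  have hHφ : Integrable (fun w : V × V => H (w.1, -w.1 + w.2)) := hmp'.integrable_comp_of_integrable hH
  have hint : Integrable (fun w : V × V => H (w.1, -w.1 + w.2) * e w) :=
    hHφ.mul_bdd (c := 1) hec.aestronglyMeasurable (ae_of_all _ fun w => (hen w).le)
  have hemb : MeasurableEmbedding (fun z : V × V => (z.1, -z.1 + z.2)) :=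
    (MeasurableEquiv.shearAddRight V).symm.measurableEmbedding
  calc _ = ∫ w : V × V, H (w.1, -w.1 + w.2) * e w := by
        rw [← hmp'.integral_comp hemb]
        simp [he]
    _ = ∫ ζ : V, ∫ ξ : V, H (ξ, -ξ + ζ) * e (ξ, ζ) := integral_prod_symm _ hint
    _ = _ := by
        rw [Real.fourier_eq']
        refine integral_congr_ae (ae_of_all _ fun ζ => ?_)
        simp only [he, smul_eq_mul]
        rw [integral_mul_const, mul_comm]
        congr 2
        rw [inner_neg_right, real_inner_comm]
        push_cast; ring

/-- Plancherel in `ζ`, then Cauchy–Schwarz in `ξ` on each fibre. Localization of the first variable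
alone bounds the fibre's volume. -/
theorem lintegral_bilinear_sq_le {H : V × V → ℂ} (hH : Integrable H) {R : ℝ}
    (hsupp : ∀ z, R < ‖z.1‖ → H z = 0) :
    ∫⁻ x : V, ‖∫ z, H z *
      Complex.exp (2 * (Real.pi : ℂ) * Complex.I * ((⟪x, z.1 + z.2⟫ : ℝ) : ℂ))‖ₑ ^ 2 ≤
      volume (Metric.closedBall (0 : V) R) * ∫⁻ z, ‖H z‖ₑ ^ 2 := by
  have hmp := measurePreserving_prod_neg_add (volume : Measure V) (volume : Measure V)
  have hmp' : MeasurePreserving (fun z : V × V => (z.1, -z.1 + z.2)) volume volume := hmp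
  have hHφ : Integrable (fun w : V × V => H (w.1, -w.1 + w.2)) := hmp'.integrable_comp_of_integrable hH
  have hsq : AEMeasurable (fun w : V × V => ‖H (w.1, -w.1 + w.2)‖ₑ ^ 2) volume :=
    hHφ.1.enorm.pow_const 2
  simp_rw [integral_mul_exp_inner_add hH]
  rw [lintegral_neg_eq_self (fun x : V => ‖𝓕 (fun ζ : V => ∫ ξ, H (ξ, -ξ + ζ)) x‖ₑ ^ 2)]
  have hsl : ∀ᵐ ζ : V, AEStronglyMeasurable (fun ξ : V => H (ξ, -ξ + ζ)) volume :=
    (hHφ.swap.prod_right_ae).mono fun ζ h => h.1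
  calc _ ≤ ∫⁻ ζ : V, ‖∫ ξ, H (ξ, -ξ + ζ)‖ₑ ^ 2 := lintegral_fourier_sq_le hHφ.integral_prod_right
    _ ≤ ∫⁻ ζ : V, volume (Metric.closedBall (0 : V) R) * ∫⁻ ξ : V, ‖H (ξ, -ξ + ζ)‖ₑ ^ 2 := by
        refine lintegral_mono_ae (hsl.mono fun ζ hζ => ?_)
        calc ‖∫ ξ, H (ξ, -ξ + ζ)‖ₑ ^ 2 ≤ (∫⁻ ξ, ‖H (ξ, -ξ + ζ)‖ₑ) ^ 2 := by
              gcongr; exact enorm_integral_le_lintegral_enorm _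
          _ = (∫⁻ ξ in Metric.closedBall (0 : V) R, 1 * ‖H (ξ, -ξ + ζ)‖ₑ) ^ 2 := by
              congr 1
              simp_rw [one_mul]
              rw [setLIntegral_eq_of_support_subset]
              intro ξ hξ
              by_contra hc
              refine hξ ?_
              simp only [Metric.mem_closedBall, dist_zero_right, not_le] at hc
              simp [hsupp (ξ, -ξ + ζ) hc]
          _ ≤ _ := by
              refine (lintegral_mul_sq_le aemeasurable_const hζ.restrict.enorm).trans ?_
              simp only [one_pow, lintegral_const, MeasurableSet.univ, Measure.restrict_apply,
                univ_inter, one_mul]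
              gcongr
              exact Measure.restrict_le_self
    _ = volume (Metric.closedBall (0 : V) R) * ∫⁻ ζ : V, ∫⁻ ξ : V, ‖H (ξ, -ξ + ζ)‖ₑ ^ 2 :=
        lintegral_const_mul' _ _ measure_closedBall_lt_top.ne
    _ = _ := by
        congr 1
        rw [← lintegral_prod_symm _ hsq]
        exact hmp'.lintegral_comp_emb (MeasurableEquiv.shearAddRight V).symm.measurableEmbedding
          (fun z => ‖H z‖ₑ ^ 2)

theorem integrable_fourier_of_contDiff {f : V → ℂ} (hf : ContDiff ℝ ∞ f)
    (hfc : HasCompactSupport f) : Integrable (𝓕 f) := by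
  have h := (𝓕 (hfc.toSchwartzMap hf)).integrable (μ := volume)
  rw [SchwartzMap.fourier_coe] at h
  exact h

theorem integrable_of_contDiff {f : V → ℂ} (hf : ContDiff ℝ ∞ f)
    (hfc : HasCompactSupport f) : Integrable f :=
  hf.continuous.integrable_of_hasCompactSupport hfc

theorem integrable_bilinear_kernel {F G : V → ℂ} (hF : Integrable F) (hG : Integrable G)
    {n : V × V → ℂ} (hn : AEStronglyMeasurable n) {C : ℝ} (hC : ∀ z, ‖n z‖ ≤ C) :
    Integrable fun z : V × V => F z.1 * G z.2 * n z :=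
  (hF.mul_prod hG).mul_bdd (c := C) hn (ae_of_all _ hC)

theorem eLpNorm_ofReal_sq (f : V → ℂ) {p : ℝ} (hp : 0 < p) :
    eLpNorm f (ENNReal.ofReal p) volume ^ 2 = (∫⁻ x, ‖f x‖ₑ ^ p) ^ (2 / p) := by
  rw [eLpNorm_eq_lintegral_rpow_enorm_toReal (by simpa using hp) ENNReal.ofReal_ne_top,
    ENNReal.toReal_ofReal hp.le, ← ENNReal.rpow_two, ← ENNReal.rpow_mul]
  congr 1; ring

/-- The `L^2` bound for a frequency-localized bilinear multiplier. -/
theorem lintegral_bilinearMultiplier_sq_le {f g : V → ℂ} (hf : ContDiff ℝ ∞ f)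
    (hfc : HasCompactSupport f) (hg : ContDiff ℝ ∞ g) (hgc : HasCompactSupport g)
    {n : V × V → ℂ} (hn : Measurable n) {K : ℝ≥0} {R : ℝ} (hR : 0 < R) (hK : ∀ z, ‖n z‖ ≤ K)
    (hsupp : ∀ z, n z ≠ 0 → ‖z.1‖ ≤ R ∧ ‖z.2‖ ≤ R)
    {p q : ℝ} (hp : 1 ≤ p) (hp2 : p ≤ 2) (hq : 1 ≤ q) (hq2 : q ≤ 2) :
    ∫⁻ x, ‖bilinearMultiplier n f g x‖ₑ ^ 2 ≤ K ^ 2 *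
      (volume (Metric.closedBall (0 : V) 1) * ENNReal.ofReal (Real.exp Real.pi) ^ 2 *
      ENNReal.ofReal (R ^ ((d : ℝ) * (2 / p + 2 / q - 1))) *
      (eLpNorm f (ENNReal.ofReal p) volume ^ 2 * eLpNorm g (ENNReal.ofReal q) volume ^ 2)) := by
  have hF := integrable_fourier_of_contDiff hf hfc
  have hG := integrable_fourier_of_contDiff hg hgc
  have h0 := integrable_bilinear_kernel hF hG hn.aestronglyMeasurable hK
  have hp0 : 0 < p := by linarith
  have hq0 : 0 < q := by linarith
  set B := Metric.closedBall (0 : V) R with hB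
  have hBm : MeasurableSet B := Metric.isClosed_closedBall.measurableSet
  have hfin : Module.finrank ℝ V = d := by simp
  have hFm : AEMeasurable (B.indicator fun ξ => ‖𝓕 f ξ‖ₑ ^ 2) := (hF.1.enorm.pow_const 2).indicator hBm
  have hGm : AEMeasurable (B.indicator fun ξ => ‖𝓕 g ξ‖ₑ ^ 2) := (hG.1.enorm.pow_const 2).indicator hBm
  have hθ : 0 ≤ 2 / p - 1 := by rw [sub_nonneg, le_div_iff₀ hp0]; linarith
  have hθ' : 0 ≤ 2 / q - 1 := by rw [sub_nonneg, le_div_iff₀ hq0]; linarith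
  calc _ ≤ volume B * ∫⁻ z : V × V, ‖𝓕 f z.1 * 𝓕 g z.2 * n z‖ₑ ^ 2 := by
        refine lintegral_bilinear_sq_le h0 fun z hz => ?_
        have : n z = 0 := by
          by_contra h
          exact absurd (hsupp z h).1 (not_le.2 hz)
        simp [this]
    -- Enlarging the support to a product of balls decouples `f` from `g`.
    _ ≤ volume B * ∫⁻ z : V × V, (K ^ 2 : ℝ≥0∞) * (B.indicator (fun ξ => ‖𝓕 f ξ‖ₑ ^ 2) z.1 *
          B.indicator (fun ξ => ‖𝓕 g ξ‖ₑ ^ 2) z.2) := by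
        gcongr with z
        by_cases hz : n z = 0
        · simp [hz]
        · have h1 : z.1 ∈ B := by simpa [hB] using (hsupp z hz).1
          have h2 : z.2 ∈ B := by simpa [hB] using (hsupp z hz).2
          rw [indicator_of_mem h1, indicator_of_mem h2, enorm_mul, enorm_mul, mul_pow, mul_pow,
            mul_comm]
          gcongr
          rw [← ofReal_norm]
          exact ENNReal.ofReal_le_of_le_toReal (by simpa using hK z)
    _ = volume B * (K ^ 2 * ((∫⁻ ξ in B, ‖𝓕 f ξ‖ₑ ^ 2) * ∫⁻ ξ in B, ‖𝓕 g ξ‖ₑ ^ 2)) := by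
        rw [lintegral_const_mul' _ _ (by simp)]
        congr 2
        rw [← lintegral_indicator hBm, ← lintegral_indicator hBm, ← lintegral_prod_mul hFm hGm]
        rfl
    _ ≤ volume B * (K ^ 2 * ((ENNReal.ofReal (Real.exp Real.pi) *
          (ENNReal.ofReal (R ^ d) ^ (2 / p - 1) * eLpNorm f (ENNReal.ofReal p) volume ^ 2)) *
          (ENNReal.ofReal (Real.exp Real.pi) *
          (ENNReal.ofReal (R ^ d) ^ (2 / q - 1) * eLpNorm g (ENNReal.ofReal q) volume ^ 2)))) := by
        rw [eLpNorm_ofReal_sq f hp0, eLpNorm_ofReal_sq g hq0]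
        have h1 := lintegral_closedBall_fourier_sq_le (integrable_of_contDiff hf hfc) hR hp hp2
        have h2 := lintegral_closedBall_fourier_sq_le (integrable_of_contDiff hg hgc) hR hq hq2
        rw [hfin] at h1 h2
        gcongr
    _ = _ := by
        have h1 : volume B = ENNReal.ofReal (R ^ d) * volume (Metric.closedBall (0 : V) 1) := by
          rw [hB, Measure.addHaar_closedBall' _ _ hR.le, hfin]
        have h2 : ENNReal.ofReal (R ^ ((d : ℝ) * (2 / p + 2 / q - 1))) =
            ENNReal.ofReal (R ^ d) * (ENNReal.ofReal (R ^ d) ^ (2 / p - 1) *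
              ENNReal.ofReal (R ^ d) ^ (2 / q - 1)) := by
          rw [ENNReal.ofReal_rpow_of_nonneg (by positivity) hθ,
            ENNReal.ofReal_rpow_of_nonneg (by positivity) hθ', ← ENNReal.ofReal_mul (by positivity),
            ← ENNReal.ofReal_mul (by positivity)]
          congr 1
          rw [← Real.rpow_natCast, ← Real.rpow_mul hR.le, ← Real.rpow_mul hR.le,
            ← Real.rpow_add hR, ← Real.rpow_add hR]
          congr 1; ring
        rw [h1, h2]
        ring

/-- Joint measurability in space and parameter, needed for Tonelli when averaging over dilations. -/
theorem measurable_bilinearMultiplier_param {U : Type*} [MeasurableSpace U] {n : U → V × V → ℂ}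
    (hn : Measurable (Function.uncurry n)) {f g : V → ℂ} (hF : Continuous (𝓕 f))
    (hG : Continuous (𝓕 g)) :
    Measurable fun w : V × U => bilinearMultiplier (n w.2) f g w.1 := by
  unfold bilinearMultiplier
  have h : Measurable fun w : (V × U) × (V × V) => 𝓕 f w.2.1 * 𝓕 g w.2.2 * n w.1.2 w.2 *
      Complex.exp (2 * (Real.pi : ℂ) * Complex.I * ((⟪w.1.1, w.2.1 + w.2.2⟫ : ℝ) : ℂ)) := by
    have h1 : Measurable fun w : (V × U) × (V × V) => n w.1.2 w.2 :=
      hn.comp ((measurable_snd.comp measurable_fst).prodMk measurable_snd)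
    have h2 : Measurable fun w : (V × U) × (V × V) => 𝓕 f w.2.1 :=
      hF.measurable.comp (measurable_fst.comp measurable_snd)
    have h3 : Measurable fun w : (V × U) × (V × V) => 𝓕 g w.2.2 :=
      hG.measurable.comp (measurable_snd.comp measurable_snd)
    fun_prop
  exact h.stronglyMeasurable.integral_prod_right.measurable

/-- Minkowski-type version of the localized `L^2` bound for averages of multipliers. -/
theorem lintegral_average_bilinearMultiplier_sq_le {U : Type*} [MeasurableSpace U] {ν : Measure U}
    [SFinite ν] {f g : V → ℂ} (hf : ContDiff ℝ ∞ f)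
    (hfc : HasCompactSupport f) (hg : ContDiff ℝ ∞ g) (hgc : HasCompactSupport g)
    {n : U → V × V → ℂ} (hn : Measurable (Function.uncurry n)) {K L : ℝ≥0} {R : ℝ} (hR : 0 < R)
    (hν : ν univ ≤ L) (hK : ∀ᵐ u ∂ν, ∀ z, ‖n u z‖ ≤ K)
    (hsupp : ∀ u z, n u z ≠ 0 → ‖z.1‖ ≤ R ∧ ‖z.2‖ ≤ R)
    {p q : ℝ} (hp : 1 ≤ p) (hp2 : p ≤ 2) (hq : 1 ≤ q) (hq2 : q ≤ 2) :
    ∫⁻ x, (∫⁻ u, ‖bilinearMultiplier (n u) f g x‖ₑ ∂ν) ^ 2 ≤ (L * K) ^ 2 *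
      (volume (Metric.closedBall (0 : V) 1) * ENNReal.ofReal (Real.exp Real.pi) ^ 2 *
      ENNReal.ofReal (R ^ ((d : ℝ) * (2 / p + 2 / q - 1))) *
      (eLpNorm f (ENNReal.ofReal p) volume ^ 2 * eLpNorm g (ENNReal.ofReal q) volume ^ 2)) := by
  have hm : Measurable fun w : V × U => ‖bilinearMultiplier (n w.2) f g w.1‖ₑ :=
    (measurable_bilinearMultiplier_param hn (fourier_continuous (integrable_of_contDiff hf hfc))
      (fourier_continuous (integrable_of_contDiff hg hgc))).enorm
  set A := volume (Metric.closedBall (0 : V) 1) * ENNReal.ofReal (Real.exp Real.pi) ^ 2 *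
      ENNReal.ofReal (R ^ ((d : ℝ) * (2 / p + 2 / q - 1))) *
      (eLpNorm f (ENNReal.ofReal p) volume ^ 2 * eLpNorm g (ENNReal.ofReal q) volume ^ 2)
  -- Cauchy–Schwarz against the constant one gives one factor `L`; integrating the uniform bound
  -- over `ν` gives the other.
  calc _ ≤ ∫⁻ x, ν univ * ∫⁻ u, ‖bilinearMultiplier (n u) f g x‖ₑ ^ 2 ∂ν := by
        refine lintegral_mono fun x => ?_
        have := lintegral_mul_sq_le (μ := ν) (f := fun _ => 1)
          (g := fun u => ‖bilinearMultiplier (n u) f g x‖ₑ) aemeasurable_const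
          (hm.comp measurable_prodMk_left).aemeasurable
        simpa using this
    _ ≤ L * ∫⁻ x : V, ∫⁻ u, ‖bilinearMultiplier (n u) f g x‖ₑ ^ 2 ∂ν := by
        rw [← lintegral_const_mul' _ _ (by simp)]
        gcongr
    _ = L * ∫⁻ u, (∫⁻ x : V, ‖bilinearMultiplier (n u) f g x‖ₑ ^ 2) ∂ν := by
        rw [lintegral_lintegral_swap]
        exact (hm.pow_const 2).aemeasurable
    _ ≤ L * ∫⁻ u, K ^ 2 * A ∂ν := by
        refine mul_le_mul_right (lintegral_mono_ae (hK.mono fun u hu => ?_)) _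
        exact lintegral_bilinearMultiplier_sq_le hf hfc hg hgc hn.of_uncurry_left hR hu (hsupp u)
          hp hp2 hq hq2
    _ = L * (K ^ 2 * A * ν univ) := by rw [lintegral_const]
    _ ≤ L * (K ^ 2 * A * L) := by gcongr
    _ = _ := by ring

end BilinearL2

/-! ### Dyadic frequency shells and differentiation in the dilation parameter. -/

section Shells

variable {d : ℕ}

local notation "V" => EuclideanSpace ℝ (Fin d)

/-- The frequency shell `2^j ≤ 1 + |ξ| + |η| < 2^(j+1)`. -/
def dyadicShell (d j : ℕ) : Set (EuclideanSpace ℝ (Fin d) × EuclideanSpace ℝ (Fin d)) :=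
  {z | 2 ^ j ≤ 1 + ‖z.1‖ + ‖z.2‖ ∧ 1 + ‖z.1‖ + ‖z.2‖ < 2 ^ (j + 1)}

theorem measurableSet_dyadicShell (j : ℕ) : MeasurableSet (dyadicShell d j) := by
  have h : Continuous fun z : V × V => 1 + ‖z.1‖ + ‖z.2‖ := by fun_prop
  exact (measurableSet_le measurable_const h.measurable).inter
    (measurableSet_lt h.measurable measurable_const)

theorem iUnion_dyadicShell : ⋃ j, dyadicShell d j = univ := by
  refine eq_univ_of_forall fun z => mem_iUnion.2 ?_
  have h1 : (1 : ℝ) ≤ 1 + ‖z.1‖ + ‖z.2‖ := by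
    have := norm_nonneg z.1; have := norm_nonneg z.2; linarith
  exact exists_nat_pow_near h1 one_lt_two

theorem pairwise_disjoint_dyadicShell : Pairwise (Function.onFun Disjoint (dyadicShell d)) := by
  intro i j hij
  rw [Function.onFun, Set.disjoint_left]
  rintro z ⟨h1, h2⟩ ⟨h3, h4⟩
  have a := (pow_lt_pow_iff_right₀ (one_lt_two : (1 : ℝ) < 2)).1 (h1.trans_lt h4)
  have b := (pow_lt_pow_iff_right₀ (one_lt_two : (1 : ℝ) < 2)).1 (h3.trans_lt h2)
  omega

theorem norm_cexp_inner (x y : V) :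
    ‖Complex.exp (2 * (Real.pi : ℂ) * Complex.I * ((⟪x, y⟫ : ℝ) : ℂ))‖ = 1 := by
  have := Complex.norm_exp_ofReal_mul_I (2 * Real.pi * ⟪x, y⟫)
  rw [← this]; congr 2; push_cast; ring

theorem integrable_bilinearMultiplier {f g : V → ℂ} (hF : Integrable (𝓕 f))
    (hG : Integrable (𝓕 g)) {n : V × V → ℂ} (hn : AEStronglyMeasurable n) {C : ℝ}
    (hC : ∀ z, ‖n z‖ ≤ C) (x : V) :
    Integrable fun z : V × V => 𝓕 f z.1 * 𝓕 g z.2 * n z *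
      Complex.exp (2 * (Real.pi : ℂ) * Complex.I * ((⟪x, z.1 + z.2⟫ : ℝ) : ℂ)) :=
  (integrable_bilinear_kernel hF hG hn hC).mul_bdd (c := 1)
    (Continuous.aestronglyMeasurable (by fun_prop))
    (ae_of_all _ fun z => (norm_cexp_inner x _).le)

theorem continuous_bilinearMultiplier {f g : V → ℂ} (hF : Integrable (𝓕 f))
    (hG : Integrable (𝓕 g)) {n : V × V → ℂ} (hn : AEStronglyMeasurable n) {C : ℝ}
    (hC : ∀ z, ‖n z‖ ≤ C) : Continuous (bilinearMultiplier n f g) := by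
  have h0 := integrable_bilinear_kernel hF hG hn hC
  refine continuous_of_dominated (fun x => (integrable_bilinearMultiplier hF hG hn hC x).1)
    (fun x => ae_of_all _ fun z => ?_) h0.norm (ae_of_all _ fun z => ?_)
  · rw [norm_mul, norm_cexp_inner, mul_one]
  · fun_prop

/-- Absolute integrability of the integrand lets the integral be split over the disjoint shells;
sharp cutoffs suffice since every later estimate is in `L^2`. -/
theorem enorm_bilinearMultiplier_le_tsum {f g : V → ℂ} (hF : Integrable (𝓕 f))
    (hG : Integrable (𝓕 g)) {n : V × V → ℂ} (hn : AEStronglyMeasurable n) {C : ℝ}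
    (hC : ∀ z, ‖n z‖ ≤ C) (x : V) :
    ‖bilinearMultiplier n f g x‖ₑ ≤
      ∑' j, ‖bilinearMultiplier ((dyadicShell d j).indicator n) f g x‖ₑ := by
  have h0 := integrable_bilinearMultiplier hF hG hn hC x
  have hs := hasSum_integral_iUnion (fun j => measurableSet_dyadicShell (d := d) j)
    pairwise_disjoint_dyadicShell (h0.integrableOn (s := ⋃ j, dyadicShell d j))
  have he : ∀ j, ∫ z in dyadicShell d j, 𝓕 f z.1 * 𝓕 g z.2 * n z *
      Complex.exp (2 * (Real.pi : ℂ) * Complex.I * ((⟪x, z.1 + z.2⟫ : ℝ) : ℂ)) =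
      bilinearMultiplier ((dyadicShell d j).indicator n) f g x := by
    intro j
    rw [bilinearMultiplier, ← integral_indicator (measurableSet_dyadicShell j)]
    refine integral_congr_ae (ae_of_all _ fun z => ?_)
    by_cases hz : z ∈ dyadicShell d j <;> simp [hz]
  simp_rw [he] at hs
  rw [iUnion_dyadicShell, setIntegral_univ] at hs
  rw [bilinearMultiplier, ← hs.tsum_eq]
  exact enorm_tsum_le_tsum_enorm

/-- The fundamental theorem of calculus in the dilation parameter, applied under the operator. -/
theorem enorm_bilinearMultiplier_indicator_le {f g : V → ℂ} (hF : Integrable (𝓕 f))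
    (hG : Integrable (𝓕 g)) {A : Set (V × V)} (hA : MeasurableSet A) {n n' : ℝ → V × V → ℂ}
    (hn : ∀ u, Continuous (n u)) (hn' : Continuous (Function.uncurry n')) {s t : ℝ} (hst : s ≤ t)
    {C : ℝ} (hd : ∀ z u, HasDerivAt (fun u => n u z) (n' u z) u)
    (hb : ∀ z ∈ A, ‖n s z‖ ≤ C) (hb' : ∀ u ∈ Icc s t, ∀ z ∈ A, ‖n' u z‖ ≤ C) (x : V) :
    ‖bilinearMultiplier (A.indicator (n t)) f g x‖ₑ ≤
      ‖bilinearMultiplier (A.indicator (n s)) f g x‖ₑ +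
        ∫⁻ u in Ioc s t, ‖bilinearMultiplier (A.indicator (n' u)) f g x‖ₑ := by
  -- A point of `A` is needed to know that `C ≥ 0`, so that the indicators also obey the bound off
  -- `A`.
  rcases A.eq_empty_or_nonempty with rfl | ⟨z₀, hz₀⟩
  · simp [bilinearMultiplier]
  have hC0 : 0 ≤ C := (norm_nonneg _).trans (hb z₀ hz₀)
  have hftc : ∀ z, n t z = n s z + ∫ u in Ioc s t, n' u z := by
    intro z
    have hc : Continuous fun u => n' u z := hn'.comp (continuous_id.prodMk continuous_const)
    have := intervalIntegral.integral_eq_sub_of_hasDerivAt (a := s) (b := t)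
      (fun u _ => hd z u) (hc.intervalIntegrable _ _)
    rw [intervalIntegral.integral_of_le hst] at this
    rw [this]; ring
  have hind : ∀ {h : V × V → ℂ}, (∀ z ∈ A, ‖h z‖ ≤ C) → ∀ z, ‖A.indicator h z‖ ≤ C := by
    intro h hh z
    by_cases hz : z ∈ A <;> simp [hz, hC0, hh]
  have hI0 := integrable_bilinearMultiplier hF hG
    (((hn s).measurable.indicator hA).aestronglyMeasurable) (hind hb) x
  set W : V × V → ℂ := fun z => 𝓕 f z.1 * 𝓕 g z.2 *
    Complex.exp (2 * (Real.pi : ℂ) * Complex.I * ((⟪x, z.1 + z.2⟫ : ℝ) : ℂ)) with hW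
  have hWi : Integrable W := by
    have := integrable_bilinearMultiplier hF hG (n := fun _ => 1) (C := 1)
      aestronglyMeasurable_const (by simp) x
    simpa using this
  have hm : Measurable fun w : (V × V) × ℝ => A.indicator (n' w.2) w.1 := by
    have : (fun w : (V × V) × ℝ => A.indicator (n' w.2) w.1) =
        (Prod.fst ⁻¹' A).indicator (fun w : (V × V) × ℝ => n' w.2 w.1) := by
      ext w; by_cases hw : w.1 ∈ A <;> simp [hw, indicator]
    rw [this]
    exact (hn'.measurable.comp measurable_swap).indicator (measurable_fst hA)
  -- Justifies exchanging the frequency integral with the integral in the dilation parameter.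
  have hprod : Integrable (fun w : (V × V) × ℝ => W w.1 * A.indicator (n' w.2) w.1)
      (volume.prod (volume.restrict (Ioc s t))) := by
    have h1 := hWi.mul_prod (integrable_const (μ := volume.restrict (Ioc s t)) (1 : ℂ))
    simp only [mul_one] at h1
    refine h1.mul_bdd (c := C) hm.aestronglyMeasurable ?_
    have h2 : (volume : Measure (V × V)).prod (volume.restrict (Ioc s t)) =
        (volume.prod volume).restrict (univ ×ˢ Ioc s t) := by
      rw [← Measure.prod_restrict, Measure.restrict_univ]
    rw [h2]
    refine ae_restrict_of_forall_mem (MeasurableSet.univ.prod measurableSet_Ioc) fun w hw => ?_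
    exact hind (hb' w.2 ⟨hw.2.1.le, hw.2.2⟩) _
  have hrepr : bilinearMultiplier (A.indicator (n t)) f g x =
      bilinearMultiplier (A.indicator (n s)) f g x +
        ∫ u in Ioc s t, bilinearMultiplier (A.indicator (n' u)) f g x := by
    have e2 : ∫ u in Ioc s t, bilinearMultiplier (A.indicator (n' u)) f g x =
        ∫ z, ∫ u in Ioc s t, W z * A.indicator (n' u) z := by
      rw [integral_integral_swap hprod]
      refine integral_congr_ae (ae_of_all _ fun u => integral_congr_ae (ae_of_all _ fun z => ?_))
      simp only [hW]; ring
    rw [e2, bilinearMultiplier, bilinearMultiplier, ← integral_add hI0 hprod.integral_prod_left]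
    refine integral_congr_ae (ae_of_all _ fun z => ?_)
    simp only
    rw [integral_const_mul]
    by_cases hz : z ∈ A
    · simp only [indicator_of_mem hz, hftc z, hW]; ring
    · simp [hz]
  rw [hrepr]
  exact (enorm_add_le _ _).trans (by gcongr; exact enorm_integral_le_lintegral_enorm _)

end Shells

/-! ### Covering numbers and Minkowski dimension. -/

section Covering

theorem exists_cover_of_subset_Icc {E : Set ℝ} (hE : E ⊆ Icc 1 2) {δ : ℝ} (hδ : 0 < δ) :
    ∃ c : Finset ℝ, c.card ≤ ⌊1 / δ⌋₊ + 1 ∧ E ⊆ ⋃ x ∈ c, Icc x (x + δ) := by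
  refine ⟨(Finset.range (⌊1 / δ⌋₊ + 1)).image fun k : ℕ => 1 + k * δ,
    Finset.card_image_le.trans (by simp), fun t ht => ?_⟩
  obtain ⟨h1, h2⟩ := hE ht
  have h0 : 0 ≤ (t - 1) / δ := div_nonneg (by linarith) hδ.le
  refine mem_iUnion₂.2 ⟨1 + (⌊(t - 1) / δ⌋₊ : ℝ) * δ,
    Finset.mem_image.2 ⟨⌊(t - 1) / δ⌋₊, ?_, rfl⟩, ?_, ?_⟩
  · rw [Finset.mem_range, Nat.lt_succ_iff]
    exact Nat.floor_le_floor (by gcongr; linarith)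
  · have := Nat.floor_le h0
    rw [le_div_iff₀ hδ] at this
    linarith
  · have := (Nat.lt_floor_add_one ((t - 1) / δ)).le
    rw [div_le_iff₀ hδ] at this
    linarith

theorem exists_cover_card_eq {E : Set ℝ} (hE : E ⊆ Icc 1 2) {δ : ℝ} (hδ : 0 < δ) :
    ∃ c : Finset ℝ, c.card = intervalCoveringNumber E δ ∧ E ⊆ ⋃ x ∈ c, Icc x (x + δ) := by
  obtain ⟨c, -, hc⟩ := exists_cover_of_subset_Icc hE hδ
  exact Nat.sInf_mem (s := {n : ℕ | ∃ c : Finset ℝ, c.card = n ∧ E ⊆ ⋃ x ∈ c, Icc x (x + δ)})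
    ⟨_, c, rfl, hc⟩

theorem intervalCoveringNumber_le {E : Set ℝ} (hE : E ⊆ Icc 1 2) {δ : ℝ} (hδ : 0 < δ) :
    intervalCoveringNumber E δ ≤ ⌊1 / δ⌋₊ + 1 := by
  obtain ⟨c, h, hc⟩ := exists_cover_of_subset_Icc hE hδ
  exact le_trans (b := c.card) (Nat.sInf_le ⟨c, rfl, hc⟩) h

/-- The trivial cover of `[1, 2]` bounds the quotient of logarithms above, so the real `limsup` does
control eventual values; exponentiating then gives the power bound. -/
theorem eventually_intervalCoveringNumber_le {E : Set ℝ} (hE : E ⊆ Icc 1 2) {γ : ℝ}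
    (hγ : upperMinkowskiDim E < γ) :
    ∀ᶠ δ in 𝓝[>] (0 : ℝ), (intervalCoveringNumber E δ : ℝ) ≤ (1 / δ) ^ γ := by
  have hsmall : ∀ᶠ δ in 𝓝[>] (0 : ℝ), δ ∈ Ioo (0 : ℝ) (1 / 2) := Ioo_mem_nhdsGT (by norm_num)
  have hbdd : IsBoundedUnder (· ≤ ·) (𝓝[>] (0 : ℝ))
      fun δ => Real.log (intervalCoveringNumber E δ) / Real.log (1 / δ) := by
    refine ⟨2, ?_⟩
    rw [eventually_map]
    filter_upwards [hsmall] with δ hδ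
    have h2 : 2 < 1 / δ := by rw [lt_div_iff₀ hδ.1]; linarith [hδ.2]
    have hlog : 0 < Real.log (1 / δ) := Real.log_pos (by linarith)
    rw [div_le_iff₀ hlog]
    rcases Nat.eq_zero_or_pos (intervalCoveringNumber E δ) with h0 | h0
    · rw [h0, Nat.cast_zero, Real.log_zero]; positivity
    have h3 : (intervalCoveringNumber E δ : ℝ) ≤ (1 / δ) ^ 2 := by
      have h4 : (intervalCoveringNumber E δ : ℝ) ≤ ⌊1 / δ⌋₊ + 1 := by
        exact_mod_cast intervalCoveringNumber_le hE hδ.1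
      have h5 := Nat.floor_le (a := 1 / δ) (by linarith)
      nlinarith
    calc _ ≤ Real.log ((1 / δ) ^ 2) := Real.log_le_log (by exact_mod_cast h0) h3
      _ = _ := by rw [Real.log_pow]; norm_num
  have := eventually_lt_of_limsup_lt hγ hbdd
  filter_upwards [this, hsmall] with δ h hδ
  have h2 : 2 < 1 / δ := by rw [lt_div_iff₀ hδ.1]; linarith [hδ.2]
  have hlog : 0 < Real.log (1 / δ) := Real.log_pos (by linarith)
  rw [div_lt_iff₀ hlog] at h
  rcases Nat.eq_zero_or_pos (intervalCoveringNumber E δ) with h0 | h0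
  · rw [h0]; push_cast; exact Real.rpow_nonneg (by linarith) _
  · rw [← Real.log_le_log_iff (by exact_mod_cast h0) (Real.rpow_pos_of_pos (by linarith) _),
      Real.log_rpow (by linarith)]
    exact h.le

theorem exists_dyadic_covers {E : Set ℝ} (hE : E ⊆ Icc 1 2) {γ : ℝ}
    (hγ : upperMinkowskiDim E < γ) :
    ∃ C : ℝ≥0, ∀ j : ℕ, ∃ c : Finset ℝ, (c.card : ℝ≥0∞) ≤ C * ENNReal.ofReal (2 ^ (γ * j)) ∧
      E ⊆ ⋃ x ∈ c, Icc x (x + (1 / 2) ^ j) := by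
  have hlim : Tendsto (fun j : ℕ => ((1 : ℝ) / 2) ^ j) atTop (𝓝[>] 0) :=
    tendsto_nhdsWithin_iff.2 ⟨tendsto_pow_atTop_nhds_zero_of_lt_one (by norm_num) (by norm_num),
      Eventually.of_forall fun j => by simp⟩
  obtain ⟨J, hJ⟩ := eventually_atTop.1 (hlim.eventually (eventually_intervalCoveringNumber_le hE hγ))
  -- The ratio is at most one from scale `J` on; the finitely many coarser scales are absorbed into
  -- the constant by summing their ratios.
  set r : ℕ → ℝ := fun j => intervalCoveringNumber E ((1 / 2) ^ j) / 2 ^ (γ * j) with hr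
  have hr0 : ∀ j, 0 ≤ r j := fun j => by simp only [hr]; positivity
  have hbound : ∀ j, r j ≤ 1 + ∑ i ∈ Finset.range J, r i := by
    intro j
    have hs : 0 ≤ ∑ i ∈ Finset.range J, r i := Finset.sum_nonneg fun i _ => hr0 i
    rcases lt_or_ge j J with h | h
    · have := Finset.single_le_sum (fun i _ => hr0 i) (Finset.mem_range.2 h)
      linarith
    · have h1 := hJ j h
      have h2 : (1 / (1 / 2 : ℝ) ^ j) ^ γ = 2 ^ (γ * j) := by
        rw [one_div_pow, one_div_one_div, ← Real.rpow_natCast, ← Real.rpow_mul (by norm_num),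
          mul_comm]
      rw [h2] at h1
      have : r j ≤ 1 := div_le_one_of_le₀ h1 (by positivity)
      linarith
  refine ⟨(1 + ∑ i ∈ Finset.range J, r i).toNNReal, fun j => ?_⟩
  obtain ⟨c, hc, hcE⟩ := exists_cover_card_eq hE (δ := (1 / 2) ^ j) (by positivity)
  refine ⟨c, ?_, hcE⟩
  rw [hc]
  have h1 := hbound j
  rw [div_le_iff₀ (by positivity)] at h1
  rw [show ((1 + ∑ i ∈ Finset.range J, r i).toNNReal : ℝ≥0∞) =
    ENNReal.ofReal (1 + ∑ i ∈ Finset.range J, r i) from rfl, ← ENNReal.ofReal_mul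
    ((hr0 j).trans (hbound j)), ← ENNReal.ofReal_natCast]
  exact ENNReal.ofReal_le_ofReal h1

end Covering

/-! ### Summing over cells and shells. -/

section Summation

variable {d : ℕ}

local notation "V" => EuclideanSpace ℝ (Fin d)

/-- Cauchy–Schwarz after writing `b j` as `2^(-δj/2) · (2^(δj/2) b j)`. -/
theorem tsum_sq_le_weighted (b : ℕ → ℝ≥0∞) (δ : ℝ) :
    (∑' j, b j) ^ 2 ≤ (∑' j : ℕ, ENNReal.ofReal (2 ^ (-δ * j))) *
      ∑' j : ℕ, ENNReal.ofReal (2 ^ (δ * j)) * b j ^ 2 := by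
  have h := lintegral_mul_sq_le (μ := (Measure.count : Measure ℕ))
    (f := fun j : ℕ => ENNReal.ofReal (2 ^ (-δ * j / 2)))
    (g := fun j : ℕ => ENNReal.ofReal (2 ^ (δ * j / 2)) * b j)
    measurable_from_nat.aemeasurable measurable_from_nat.aemeasurable
  simp only [lintegral_count, mul_pow, ← ENNReal.ofReal_pow (Real.rpow_nonneg zero_le_two _),
    ← mul_assoc, ← ENNReal.ofReal_mul (Real.rpow_nonneg zero_le_two _),
    ← Real.rpow_natCast (2 ^ (_ : ℝ)) 2, ← Real.rpow_mul zero_le_two,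
    ← Real.rpow_add zero_lt_two] at h
  convert h using 4 with j j j
  · rw [show -δ * j / 2 + δ * j / 2 = 0 by ring]; simp
  · congr 2; push_cast; ring
  · congr 3; push_cast; ring

theorem tsum_ofReal_two_rpow_ne_top {δ : ℝ} (hδ : 0 < δ) :
    ∑' j : ℕ, ENNReal.ofReal (2 ^ (-δ * j)) ≠ ⊤ := by
  refine Summable.tsum_ofReal_ne_top ?_
  simp_rw [Real.rpow_mul zero_le_two, Real.rpow_natCast]
  exact summable_geometric_of_lt_one (by positivity)
    (Real.rpow_lt_one_of_one_lt_of_neg one_lt_two (by linarith))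

/-- A maximal function is bounded once, on each frequency shell, it is dominated by
few functions with small `L^2` norms. -/
theorem boundedOnLebesgue_of_cells {τ ι : Type*} {T : Set τ} {n : τ → V × V → ℂ} {p q γ s : ℝ}
    (hγ : γ + s < 0) {C : ℝ≥0} (hcont : ∀ t ∈ T, Continuous (n t))
    (hbdd : ∀ t ∈ T, ∃ M : ℝ, ∀ z, ‖n t z‖ ≤ M)
    (hcells : ∀ j : ℕ, ∃ S : Finset ι, (S.card : ℝ≥0∞) ≤ C * ENNReal.ofReal (2 ^ (γ * j)) ∧
      ∀ f g : V → ℂ, ContDiff ℝ ∞ f → HasCompactSupport f → ContDiff ℝ ∞ g →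
        HasCompactSupport g → ∃ Φ : ι → V → ℝ≥0∞, (∀ i, Measurable (Φ i)) ∧
          (∀ i ∈ S, ∫⁻ x, Φ i x ^ 2 ≤ C * ENNReal.ofReal (2 ^ (s * j)) *
            (eLpNorm f (ENNReal.ofReal p) volume ^ 2 *
              eLpNorm g (ENNReal.ofReal q) volume ^ 2)) ∧
          ∀ t ∈ T, ∃ i ∈ S, ∀ x,
            ‖bilinearMultiplier ((dyadicShell d j).indicator (n t)) f g x‖ₑ ≤ Φ i x) :
    BoundedOnLebesgue (fun f g (x : V) => ⨆ t ∈ T, ‖bilinearMultiplier (n t) f g x‖ₑ) p q 2 := by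
  -- Half the available decay: `δ + γ + s = -δ`, so both geometric series are the same convergent
  -- one.
  set δ := -(γ + s) / 2 with hδ
  have hδ0 : 0 < δ := by rw [hδ]; linarith
  set W := ∑' j : ℕ, ENNReal.ofReal (2 ^ (-δ * j)) with hW
  have hWt : W ≠ ⊤ := tsum_ofReal_two_rpow_ne_top hδ0
  refine ⟨C * W.toNNReal, fun f g hf hfc hg hgc => ?_⟩
  have hF := integrable_fourier_of_contDiff hf hfc
  have hG := integrable_fourier_of_contDiff hg hgc
  refine ⟨?_, ?_⟩
  -- A supremum of continuous functions is lower semicontinuous, so an uncountable `T` causes no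
  -- measurability problem.
  · refine LowerSemicontinuous.measurable (lowerSemicontinuous_biSup fun t ht => ?_)
    obtain ⟨M, hM⟩ := hbdd t ht
    exact (continuous_bilinearMultiplier hF hG (hcont t ht).aestronglyMeasurable
      hM).enorm.lowerSemicontinuous
  choose S hS hΦ using hcells
  choose Φ hΦm hΦ2 hΦd using fun j => hΦ j f g hf hfc hg hgc
  set N := eLpNorm f (ENNReal.ofReal p) volume ^ 2 * eLpNorm g (ENNReal.ofReal q) volume ^ 2 with hN
  -- The `ℓ²` sum over cells dominates every cell, and its squared norm is just the sum of theirs.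
  set b : ℕ → V → ℝ≥0∞ := fun j x => (∑ i ∈ S j, Φ j i x ^ 2) ^ (1 / 2 : ℝ) with hb
  have hb2 : ∀ j x, b j x ^ 2 = ∑ i ∈ S j, Φ j i x ^ 2 := by
    intro j x
    simp only [hb]
    rw [← ENNReal.rpow_two, ← ENNReal.rpow_mul]; norm_num
  have hle : ∀ j x, ∀ i ∈ S j, Φ j i x ≤ b j x := by
    intro j x i hi
    rw [← ENNReal.pow_le_pow_left_iff two_ne_zero, hb2]
    exact Finset.single_le_sum (f := fun i => Φ j i x ^ 2) (fun _ _ => zero_le) hi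
  have hsup : ∀ x, (⨆ t ∈ T, ‖bilinearMultiplier (n t) f g x‖ₑ) ≤ ∑' j, b j x := by
    intro x
    refine iSup₂_le fun t ht => ?_
    obtain ⟨M, hM⟩ := hbdd t ht
    refine (enorm_bilinearMultiplier_le_tsum hF hG (hcont t ht).aestronglyMeasurable hM x).trans ?_
    refine ENNReal.tsum_le_tsum fun j => ?_
    obtain ⟨i, hi, h⟩ := hΦd j t ht
    exact (h x).trans (hle j x i hi)
  have hint : ∫⁻ x, (⨆ t ∈ T, ‖bilinearMultiplier (n t) f g x‖ₑ) ^ 2 ≤ (C * W) ^ 2 * N := by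
    calc _ ≤ ∫⁻ x, W * ∑' j : ℕ, ENNReal.ofReal (2 ^ (δ * j)) * ∑ i ∈ S j, Φ j i x ^ 2 := by
          refine lintegral_mono fun x => ?_
          refine (pow_le_pow_left' (hsup x) 2).trans ?_
          simp_rw [← hb2]
          exact tsum_sq_le_weighted (fun j => b j x) δ
      _ = W * ∑' j : ℕ, ENNReal.ofReal (2 ^ (δ * j)) * ∑ i ∈ S j, ∫⁻ x, Φ j i x ^ 2 := by
          rw [lintegral_const_mul' _ _ hWt, lintegral_tsum]
          · congr 2; ext j
            rw [lintegral_const_mul' _ _ ENNReal.ofReal_ne_top, lintegral_finsetSum]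
            exact fun i _ => (hΦm j i).pow_const 2
          · intro j
            exact ((Finset.measurable_fun_sum _
              fun i _ => (hΦm j i).pow_const 2).const_mul _).aemeasurable
      _ ≤ W * ∑' j : ℕ, ENNReal.ofReal (2 ^ (-δ * j)) * (C ^ 2 * N) := by
          refine mul_le_mul_right (ENNReal.tsum_le_tsum fun j => ?_) _
          calc _ ≤ ENNReal.ofReal (2 ^ (δ * j)) *
                ∑ i ∈ S j, C * ENNReal.ofReal (2 ^ (s * j)) * N := by
                  gcongr with i hi
                  exact hΦ2 j i hi
            _ = ENNReal.ofReal (2 ^ (δ * j)) * ((S j).card * (C * ENNReal.ofReal (2 ^ (s * j)) * N)) := by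
                  rw [Finset.sum_const, nsmul_eq_mul]
            _ ≤ ENNReal.ofReal (2 ^ (δ * j)) * (C * ENNReal.ofReal (2 ^ (γ * j)) *
                  (C * ENNReal.ofReal (2 ^ (s * j)) * N)) := by gcongr; exact hS j
            _ = (ENNReal.ofReal (2 ^ (δ * j)) * (ENNReal.ofReal (2 ^ (γ * j)) *
                  ENNReal.ofReal (2 ^ (s * j)))) * (C ^ 2 * N) := by ring
            _ = _ := by
                  rw [← ENNReal.ofReal_mul (by positivity), ← ENNReal.ofReal_mul (by positivity),
                    ← Real.rpow_add zero_lt_two, ← Real.rpow_add zero_lt_two]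
                  congr 3
                  rw [hδ]; ring
      _ = _ := by rw [ENNReal.tsum_mul_right]; ring
  rw [← ENNReal.pow_le_pow_left_iff two_ne_zero, eLpNorm_eq_lintegral_rpow_enorm_toReal (by simp)
    ENNReal.ofReal_ne_top, ENNReal.toReal_ofReal zero_le_two, ← ENNReal.rpow_two,
    ← ENNReal.rpow_mul]
  have hWW : ((W.toNNReal : ℝ≥0) : ℝ≥0∞) = W := ENNReal.coe_toNNReal hWt
  push_cast
  rw [hWW]
  norm_num
  calc _ ≤ _ := hint
    _ = _ := by rw [hN]; ring

end Summation

/-! ### Estimates on a single shell and a single parameter cell. -/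

section Cells

variable {d : ℕ}

local notation "V" => EuclideanSpace ℝ (Fin d)

theorem norm_le_of_mem_dyadicShell {j : ℕ} {z : V × V} (hz : z ∈ dyadicShell d j) :
    ‖z.1‖ ≤ 2 ^ (j + 1) ∧ ‖z.2‖ ≤ 2 ^ (j + 1) := by
  have := norm_nonneg z.1
  have := norm_nonneg z.2
  have := hz.2
  constructor <;> linarith

theorem measurable_indicator_param {U : Type*} [MeasurableSpace U] {A : Set (V × V)}
    (hA : MeasurableSet A) {n : U → V × V → ℂ} (hn : Measurable (Function.uncurry n)) :
    Measurable (Function.uncurry fun u => A.indicator (n u)) := by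
  have : (Function.uncurry fun u => A.indicator (n u)) =
      (Prod.snd ⁻¹' A).indicator (Function.uncurry n) := by
    ext w; by_cases hw : w.2 ∈ A <;> simp [hw, indicator, Function.uncurry]
  rw [this]
  exact hn.indicator (measurable_snd hA)

/-- `L^2` bound on the shell `j` for an average, over a set of measure `≤ 2^(-jl)`, of multipliers
of size `2^(-ja) 2^((j+1)l)`. -/
theorem exists_shell_average_bound (a : ℝ) (C : ℝ≥0) {p q : ℝ} (hp : 1 ≤ p) (hp2 : p ≤ 2)
    (hq : 1 ≤ q) (hq2 : q ≤ 2) : ∃ c : ℝ≥0, ∀ j l : ℕ, l ≤ 2 → ∀ (U : Type) [MeasurableSpace U]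
      (ν : Measure U) [SFinite ν] (n : U → V × V → ℂ), Measurable (Function.uncurry n) →
      ν univ ≤ ENNReal.ofReal ((1 / 2) ^ (j * l)) →
      (∀ᵐ u ∂ν, ∀ z ∈ dyadicShell d j, ‖n u z‖ ≤ C * (2 ^ j : ℝ) ^ (-a) * 2 ^ ((j + 1) * l)) →
      ∀ f g : V → ℂ, ContDiff ℝ ∞ f → HasCompactSupport f → ContDiff ℝ ∞ g →
        HasCompactSupport g →
      ∫⁻ x, (∫⁻ u, ‖bilinearMultiplier ((dyadicShell d j).indicator (n u)) f g x‖ₑ ∂ν) ^ 2 ≤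
        c * ENNReal.ofReal (2 ^ ((d * (2 / p + 2 / q - 1) - 2 * a) * j)) *
          (eLpNorm f (ENNReal.ofReal p) volume ^ 2 *
            eLpNorm g (ENNReal.ofReal q) volume ^ 2) := by
  set e : ℝ := d * (2 / p + 2 / q - 1) with he
  set D : ℝ≥0∞ := volume (Metric.closedBall (0 : V) 1) * ENNReal.ofReal (Real.exp Real.pi) ^ 2
    with hD
  have hDt : D ≠ ⊤ := ENNReal.mul_ne_top measure_closedBall_lt_top.ne (by simp)
  -- The `4` bounds the `2^l` left from `2^(-jl) · 2^((j+1)l)` with `l ≤ 2`; the factor `2^e` comes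
  -- from the radius `2^(j+1)` in place of `2^j`.
  refine ⟨D.toNNReal * (4 * C) ^ 2 * Real.toNNReal (2 ^ e), ?_⟩
  intro j l hl U _ ν _ n hn hν hK f g hf hfc hg hgc
  set K : ℝ≥0 := C * ((2 : ℝ≥0) ^ j) ^ (-a) * 2 ^ ((j + 1) * l) with hKdef
  have hKc : (K : ℝ) = C * (2 ^ j : ℝ) ^ (-a) * 2 ^ ((j + 1) * l) := by
    rw [hKdef]; push_cast; rfl
  set L : ℝ≥0 := (1 / 2) ^ (j * l) with hL
  have hLc : (L : ℝ≥0∞) = ENNReal.ofReal ((1 / 2) ^ (j * l)) := by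
    rw [ENNReal.ofReal]
    congr 1
    ext
    rw [Real.coe_toNNReal _ (by positivity), hL]
    push_cast; rfl
  have key := lintegral_average_bilinearMultiplier_sq_le (ν := ν) hf hfc hg hgc
    (n := fun u => (dyadicShell d j).indicator (n u))
    (measurable_indicator_param (measurableSet_dyadicShell j) hn) (K := K) (L := L)
    (R := 2 ^ (j + 1)) (by positivity) (hν.trans hLc.ge) (hK.mono fun u hu z => by
      by_cases hz : z ∈ dyadicShell d j
      · rw [indicator_of_mem hz, hKc]; exact hu z hz
      · rw [indicator_of_notMem hz, norm_zero]; exact K.2) (fun u z hz => by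
      by_cases hz' : z ∈ dyadicShell d j
      · exact norm_le_of_mem_dyadicShell hz'
      · exact absurd (indicator_of_notMem hz' _) hz) hp hp2 hq hq2
  refine key.trans ?_
  have hLK : (L : ℝ≥0∞) * K ≤ ENNReal.ofReal (4 * C * 2 ^ (-a * j)) := by
    rw [← ENNReal.coe_mul, ENNReal.coe_le_iff]
    intro r hr
    rw [ENNReal.ofReal, ENNReal.coe_inj] at hr
    rw [← hr, ← NNReal.coe_le_coe, Real.coe_toNNReal _ (by positivity), NNReal.coe_mul, hKc, hL]
    have h2 : ((2 : ℝ) ^ j) ^ (-a) = 2 ^ (-a * j) := by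
      rw [← Real.rpow_natCast, ← Real.rpow_mul zero_le_two, mul_comm]
    rw [h2]
    push_cast
    have h3 : ((1 : ℝ) / 2) ^ (j * l) * 2 ^ ((j + 1) * l) = 2 ^ l := by
      rw [add_mul, pow_add, ← mul_assoc, ← mul_pow]; norm_num
    have h4 : (2 : ℝ) ^ l ≤ 4 := by
      calc (2 : ℝ) ^ l ≤ 2 ^ 2 := pow_le_pow_right₀ one_le_two hl
        _ = 4 := by norm_num
    calc _ = (C * 2 ^ (-a * j)) * (((1 : ℝ) / 2) ^ (j * l) * 2 ^ ((j + 1) * l)) := by ring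
      _ ≤ (C * 2 ^ (-a * j)) * 4 := by rw [h3]; gcongr
      _ = _ := by ring
  have hR : ((2 : ℝ) ^ (j + 1)) ^ e = 2 ^ e * 2 ^ (e * j) := by
    rw [← Real.rpow_natCast, ← Real.rpow_mul zero_le_two, ← Real.rpow_add zero_lt_two]
    congr 1; push_cast; ring
  rw [hR, ENNReal.ofReal_mul (by positivity)]
  set N := eLpNorm f (ENNReal.ofReal p) volume ^ 2 * eLpNorm g (ENNReal.ofReal q) volume ^ 2
  calc _ ≤ ENNReal.ofReal (4 * C * 2 ^ (-a * j)) ^ 2 *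
        (D * (ENNReal.ofReal (2 ^ e) * ENNReal.ofReal (2 ^ (e * j))) * N) := by gcongr
    _ = (D * ENNReal.ofReal (4 * C) ^ 2 * ENNReal.ofReal (2 ^ e)) *
        (ENNReal.ofReal (2 ^ (-a * j)) ^ 2 * ENNReal.ofReal (2 ^ (e * j))) * N := by
        rw [ENNReal.ofReal_mul (by positivity)]; ring
    _ = _ := by
        congr 2
        · push_cast
          rw [ENNReal.coe_toNNReal hDt]
          congr 3
          rw [ENNReal.ofReal_mul (by norm_num), ENNReal.ofReal_coe_nnreal]
          norm_num
        · rw [← ENNReal.ofReal_pow (by positivity), ← ENNReal.ofReal_mul (by positivity),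
            ← Real.rpow_natCast, ← Real.rpow_mul zero_le_two, ← Real.rpow_add zero_lt_two]
          congr 2; push_cast; ring

/-- The left endpoint of the part of `[c, c + h]` inside `[1, 2]`. -/
def cellStart (c : ℝ) : ℝ := min 2 (max 1 c)

/-- The part of `[c, c + h]` inside `[1, 2]`, up to the left endpoint. -/
def cell (c h : ℝ) : Set ℝ := Ioc (cellStart c) (min 2 (cellStart c + h))

theorem cellStart_mem (c : ℝ) : cellStart c ∈ Icc (1 : ℝ) 2 :=
  ⟨le_min (by norm_num) (le_max_left _ _), min_le_left _ _⟩

/-- Covering intervals may leave `[1, 2]`; clamping them keeps every parameter in the range where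
`shell_decay` applies. -/
theorem cell_subset (c h : ℝ) : cell c h ⊆ Icc 1 2 := fun _ hu =>
  ⟨(cellStart_mem c).1.trans hu.1.le, hu.2.trans (min_le_left _ _)⟩

theorem measurableSet_cell (c h : ℝ) : MeasurableSet (cell c h) := measurableSet_Ioc

theorem volume_cell_le (c h : ℝ) : volume (cell c h) ≤ ENNReal.ofReal h := by
  rw [cell, Real.volume_Ioc]
  refine ENNReal.ofReal_le_ofReal ?_
  have := min_le_right 2 (cellStart c + h)
  linarith

theorem cellStart_le {c h t : ℝ} (ht : t ∈ Icc (1 : ℝ) 2) (htc : t ∈ Icc c (c + h)) :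
    cellStart c ≤ t :=
  (min_le_right _ _).trans (max_le ht.1 htc.1)

theorem Ioc_subset_cell {c h t : ℝ} (ht : t ∈ Icc (1 : ℝ) 2) (htc : t ∈ Icc c (c + h)) :
    Ioc (cellStart c) t ⊆ cell c h := by
  refine Ioc_subset_Ioc_right (le_min ht.2 ?_)
  have : c ≤ cellStart c := le_min (htc.1.trans ht.2) (le_max_right _ _)
  linarith [htc.2]

theorem Icc_cellStart_subset {c t : ℝ} (ht : t ∈ Icc (1 : ℝ) 2) :
    Icc (cellStart c) t ⊆ Icc 1 2 :=
  Icc_subset_Icc (cellStart_mem c).1 ht.2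

theorem IsAdmissibleMultiplier.exists_uniform_decay {m : V × V → ℂ} {a : ℝ} {k : ℕ}
    (hm : IsAdmissibleMultiplier m a k) : ∃ C : ℝ≥0, ∀ i ≤ k, ∀ ξ η : V,
      ‖iteratedFDeriv ℝ i m (ξ, η)‖ ≤ C / (1 + ‖ξ‖ + ‖η‖) ^ a := by
  choose! C hC using hm.decay
  refine ⟨∑ i ∈ Finset.range (k + 1), (C i).toNNReal, fun i hi ξ η => (hC i hi ξ η).trans ?_⟩
  gcongr
  refine (Real.le_coe_toNNReal _).trans (NNReal.coe_le_coe.2 ?_)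
  exact Finset.single_le_sum (f := fun i => (C i).toNNReal) (fun _ _ => zero_le)
    (Finset.mem_range.2 (Nat.lt_succ_of_le hi))

/-- Dilating by factors at least one does not decrease norms, so the lower bound defining the shell
survives at the dilated point. -/
theorem shell_decay {h : ℝ} {a : ℝ} (ha : 0 ≤ a) {C : ℝ≥0} {j : ℕ} {z : V × V}
    (hz : z ∈ dyadicShell d j) {u v : ℝ} (hu : u ∈ Icc (1 : ℝ) 2) (hv : v ∈ Icc (1 : ℝ) 2)
    (hh : h ≤ C / (1 + ‖u • z.1‖ + ‖v • z.2‖) ^ a) : h ≤ C * (2 ^ j : ℝ) ^ (-a) := by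
  refine hh.trans ?_
  rw [Real.rpow_neg (by positivity), ← div_eq_mul_inv]
  have h1 : ‖z.1‖ ≤ ‖u • z.1‖ := by
    rw [norm_smul, Real.norm_of_nonneg (by linarith [hu.1])]
    exact le_mul_of_one_le_left (norm_nonneg _) hu.1
  have h2 : ‖z.2‖ ≤ ‖v • z.2‖ := by
    rw [norm_smul, Real.norm_of_nonneg (by linarith [hv.1])]
    exact le_mul_of_one_le_left (norm_nonneg _) hv.1
  have h3 := hz.1
  gcongr
  linarith

theorem IsAdmissibleMultiplier.norm_le {m : V × V → ℂ} {a : ℝ} (ha : 0 ≤ a) {C : ℝ≥0}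
    (hC : ∀ ξ η : V, ‖iteratedFDeriv ℝ 0 m (ξ, η)‖ ≤ C / (1 + ‖ξ‖ + ‖η‖) ^ a) (z : V × V) :
    ‖m z‖ ≤ C := by
  have h := hC z.1 z.2
  rw [norm_iteratedFDeriv_zero] at h
  refine h.trans (div_le_self C.2 (Real.one_le_rpow ?_ ha))
  have := norm_nonneg z.1
  have := norm_nonneg z.2
  linarith

/-- The derivative falls in the direction `z` itself, of size at most `2^(j+1)` on shell `j`; this
is the loss repaid by the cell length. -/
theorem hasDerivAt_dilate {F : Type*} [NormedAddCommGroup F] [NormedSpace ℝ F] {m : V × V → F}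
    (hm : Differentiable ℝ m) (z : V × V) (u : ℝ) :
    HasDerivAt (fun u : ℝ => m (u • z.1, u • z.2)) (fderiv ℝ m (u • z.1, u • z.2) z) u := by
  have h : HasDerivAt (fun u : ℝ => (u • z.1, u • z.2)) (z.1, z.2) u := by
    simpa using! ((hasDerivAt_id u).smul_const z.1).prodMk ((hasDerivAt_id u).smul_const z.2)
  exact (hm (u • z.1, u • z.2)).hasFDerivAt.comp_hasDerivAt u h

theorem hasDerivAt_dilate_fst {F : Type*} [NormedAddCommGroup F] [NormedSpace ℝ F] {m : V × V → F}
    (hm : Differentiable ℝ m) (z : V × V) (u v : ℝ) :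
    HasDerivAt (fun u : ℝ => m (u • z.1, v • z.2)) (fderiv ℝ m (u • z.1, v • z.2) (z.1, 0)) u := by
  have h : HasDerivAt (fun u : ℝ => (u • z.1, v • z.2)) (z.1, 0) u := by
    simpa using! ((hasDerivAt_id u).smul_const z.1).prodMk (hasDerivAt_const u (v • z.2))
  exact (hm (u • z.1, v • z.2)).hasFDerivAt.comp_hasDerivAt u h

theorem hasDerivAt_dilate_snd {F : Type*} [NormedAddCommGroup F] [NormedSpace ℝ F] {m : V × V → F}
    (hm : Differentiable ℝ m) (z : V × V) (u v : ℝ) :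
    HasDerivAt (fun v : ℝ => m (u • z.1, v • z.2)) (fderiv ℝ m (u • z.1, v • z.2) (0, z.2)) v := by
  have h : HasDerivAt (fun v : ℝ => (u • z.1, v • z.2)) (0, z.2) v := by
    simpa using! (hasDerivAt_const v (u • z.1)).prodMk ((hasDerivAt_id v).smul_const z.2)
  exact (hm (u • z.1, v • z.2)).hasFDerivAt.comp_hasDerivAt v h

theorem ENNReal_add_sq_le (a b : ℝ≥0∞) : (a + b) ^ 2 ≤ 4 * (a ^ 2 + b ^ 2) := by
  calc (a + b) ^ 2 ≤ (max a b + max a b) ^ 2 := by gcongr; exacts [le_max_left _ _, le_max_right _ _]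
    _ = 4 * max a b ^ 2 := by ring
    _ ≤ _ := by
      gcongr
      rcases max_cases a b with h | h
      · rw [h.1]; exact le_self_add
      · rw [h.1]; exact le_add_self

theorem lintegral_add_sq_le {α : Type*} [MeasurableSpace α] {μ : Measure α} {F G : α → ℝ≥0∞}
    (hF : Measurable F) {B B' : ℝ≥0∞} (h1 : ∫⁻ x, F x ^ 2 ∂μ ≤ B) (h2 : ∫⁻ x, G x ^ 2 ∂μ ≤ B') :
    ∫⁻ x, (F x + G x) ^ 2 ∂μ ≤ 4 * (B + B') := by
  calc _ ≤ ∫⁻ x, 4 * (F x ^ 2 + G x ^ 2) ∂μ := lintegral_mono fun x => ENNReal_add_sq_le _ _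
    _ = 4 * (∫⁻ x, F x ^ 2 ∂μ + ∫⁻ x, G x ^ 2 ∂μ) := by
        rw [lintegral_const_mul' _ _ (by norm_num), lintegral_add_left (hF.pow_const 2)]
    _ ≤ _ := by gcongr

end Cells

/-! ### The two maximal operators. -/

section Maximal

variable {d : ℕ}

local notation "V" => EuclideanSpace ℝ (Fin d)

theorem continuous_dilate {m : V × V → ℂ} (hm : Continuous m) (u v : ℝ) :
    Continuous fun z : V × V => m (u • z.1, v • z.2) := by fun_prop

theorem measurable_lintegral_bilinearMultiplier {U : Type*} [MeasurableSpace U] {ν : Measure U}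
    [SFinite ν] {f g : V → ℂ} (hF : Continuous (𝓕 f)) (hG : Continuous (𝓕 g)) {j : ℕ}
    {n : U → V × V → ℂ} (hn : Measurable (Function.uncurry n)) :
    Measurable fun x => ∫⁻ u, ‖bilinearMultiplier ((dyadicShell d j).indicator (n u)) f g x‖ₑ ∂ν :=
  (measurable_bilinearMultiplier_param (measurable_indicator_param
    (measurableSet_dyadicShell j) hn) hF hG).enorm.lintegral_prod_right'

/-- The pointwise case of `exists_shell_average_bound` together with the averaged one. -/
theorem exists_shell_bounds (a : ℝ) (C : ℝ≥0) {p q : ℝ} (hp : 1 ≤ p) (hp2 : p ≤ 2)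
    (hq : 1 ≤ q) (hq2 : q ≤ 2) : ∃ c : ℝ≥0, ∀ j : ℕ, ∀ f g : V → ℂ, ContDiff ℝ ∞ f →
      HasCompactSupport f → ContDiff ℝ ∞ g → HasCompactSupport g →
      (∀ n : V × V → ℂ, Measurable n →
        (∀ z ∈ dyadicShell d j, ‖n z‖ ≤ C * (2 ^ j : ℝ) ^ (-a)) →
        ∫⁻ x, ‖bilinearMultiplier ((dyadicShell d j).indicator n) f g x‖ₑ ^ 2 ≤
          c * ENNReal.ofReal (2 ^ ((d * (2 / p + 2 / q - 1) - 2 * a) * j)) *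
          (eLpNorm f (ENNReal.ofReal p) volume ^ 2 * eLpNorm g (ENNReal.ofReal q) volume ^ 2)) ∧
      (∀ n : ℝ → V × V → ℂ, Measurable (Function.uncurry n) → ∀ b : ℝ,
        (∀ u ∈ Icc (1 : ℝ) 2, ∀ z ∈ dyadicShell d j,
          ‖n u z‖ ≤ C * (2 ^ j : ℝ) ^ (-a) * 2 ^ (j + 1)) →
        ∫⁻ x, (∫⁻ u in cell b ((1 / 2) ^ j),
          ‖bilinearMultiplier ((dyadicShell d j).indicator (n u)) f g x‖ₑ) ^ 2 ≤
          c * ENNReal.ofReal (2 ^ ((d * (2 / p + 2 / q - 1) - 2 * a) * j)) *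
          (eLpNorm f (ENNReal.ofReal p) volume ^ 2 * eLpNorm g (ENNReal.ofReal q) volume ^ 2)) ∧
      (∀ n : ℝ → ℝ → V × V → ℂ, Measurable (fun w : (ℝ × ℝ) × (V × V) => n w.1.1 w.1.2 w.2) →
        ∀ b b' : ℝ, (∀ u ∈ Icc (1 : ℝ) 2, ∀ v ∈ Icc (1 : ℝ) 2, ∀ z ∈ dyadicShell d j,
          ‖n u v z‖ ≤ C * (2 ^ j : ℝ) ^ (-a) * (2 ^ (j + 1) * 2 ^ (j + 1))) →
        ∫⁻ x, (∫⁻ w : ℝ × ℝ,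
          ‖bilinearMultiplier ((dyadicShell d j).indicator (n w.1 w.2)) f g x‖ₑ
          ∂((volume.restrict (cell b ((1 / 2) ^ j))).prod
            (volume.restrict (cell b' ((1 / 2) ^ j))))) ^ 2 ≤
          c * ENNReal.ofReal (2 ^ ((d * (2 / p + 2 / q - 1) - 2 * a) * j)) *
          (eLpNorm f (ENNReal.ofReal p) volume ^ 2 *
            eLpNorm g (ENNReal.ofReal q) volume ^ 2)) := by
  obtain ⟨c, hc⟩ := exists_shell_average_bound (d := d) a C hp hp2 hq hq2
  refine ⟨c, fun j f g hf hfc hg hgc => ⟨fun n hn hb => ?_, fun n hn b hb => ?_,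
    fun n hn b b' hb => ?_⟩⟩
  -- A single multiplier is an average over a point mass, with `l = 0`.
  · have := hc j 0 (by norm_num) Unit (Measure.dirac ()) (fun _ => n) (hn.comp measurable_snd)
      (by simp) (ae_of_all _ fun _ z hz => by simpa using hb z hz) f g hf hfc hg hgc
    simpa using this
  · refine hc j 1 (by norm_num) ℝ (volume.restrict (cell b ((1 / 2) ^ j))) n hn ?_ ?_ f g hf hfc
      hg hgc
    · rw [Measure.restrict_apply_univ, mul_one]
      exact volume_cell_le _ _
    · refine ae_restrict_of_forall_mem (measurableSet_cell _ _) fun u hu z hz => ?_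
      rw [mul_one]
      exact hb u (cell_subset _ _ hu) z hz
  · refine hc j 2 le_rfl (ℝ × ℝ) _ (fun w => n w.1 w.2) hn ?_ ?_ f g hf hfc hg hgc
    · rw [← univ_prod_univ, Measure.prod_prod, Measure.restrict_apply_univ,
        Measure.restrict_apply_univ, pow_mul, sq, ENNReal.ofReal_mul (by positivity)]
      exact mul_le_mul' (volume_cell_le _ _) (volume_cell_le _ _)
    · rw [Measure.prod_restrict]
      refine ae_restrict_of_forall_mem
        ((measurableSet_cell _ _).prod (measurableSet_cell _ _)) fun w hw z hz => ?_
      have := hb w.1 (cell_subset _ _ hw.1) w.2 (cell_subset _ _ hw.2) z hz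
      rwa [pow_mul, sq]

/-- Each covering interval yields one dominating function: the endpoint value plus the integrated
derivative over the cell. Both obey the same shell bound, so the interval count alone costs
`2^(γj)`. -/
theorem boundedOnLebesgue_singleScaleMaximal {m : V × V → ℂ} {a : ℝ}
    (hm : IsAdmissibleMultiplier m a 1) {E : Set ℝ} (hE : E ⊆ Icc 1 2) {γ : ℝ}
    (hγ : upperMinkowskiDim E < γ) {p q : ℝ} (hp : 1 ≤ p) (hp2 : p ≤ 2) (hq : 1 ≤ q) (hq2 : q ≤ 2)
    (hs : γ + (d * (2 / p + 2 / q - 1) - 2 * a) < 0) :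
    BoundedOnLebesgue (singleScaleMaximal m E) p q 2 := by
  have ha : 0 ≤ a := (by positivity : (0 : ℝ) ≤ d / 2).trans hm.half_dim_lt.le
  obtain ⟨C, hC⟩ := hm.exists_uniform_decay
  obtain ⟨c, hc⟩ := exists_shell_bounds (d := d) a C hp hp2 hq hq2
  obtain ⟨C', hC'⟩ := exists_dyadic_covers hE hγ
  have hmc : Continuous m := hm.contDiff.continuous
  have hmd : Differentiable ℝ m := hm.contDiff.differentiable (by norm_num)
  have hfd : Continuous (fderiv ℝ m) := hm.contDiff.continuous_fderiv (by norm_num)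
  set n : ℝ → V × V → ℂ := fun u z => m (u • z.1, u • z.2) with hn
  set n' : ℝ → V × V → ℂ := fun u z => fderiv ℝ m (u • z.1, u • z.2) z with hn'
  have hn'c : Continuous (Function.uncurry n') := by
    simp only [hn', Function.uncurry_def]
    exact (hfd.comp (by fun_prop)).clm_apply continuous_snd
  have hbn : ∀ j, ∀ z ∈ dyadicShell d j, ∀ u ∈ Icc (1 : ℝ) 2,
      ‖n u z‖ ≤ C * (2 ^ j : ℝ) ^ (-a) := by
    intro j z hz u hu
    refine shell_decay ha hz hu hu ?_
    have := hC 0 (by norm_num) (u • z.1) (u • z.2)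
    rwa [norm_iteratedFDeriv_zero] at this
  have hbn' : ∀ j, ∀ z ∈ dyadicShell d j, ∀ u ∈ Icc (1 : ℝ) 2,
      ‖n' u z‖ ≤ C * (2 ^ j : ℝ) ^ (-a) * 2 ^ (j + 1) := by
    intro j z hz u hu
    refine (ContinuousLinearMap.le_opNorm _ _).trans ?_
    obtain ⟨h1, h2⟩ := norm_le_of_mem_dyadicShell hz
    refine mul_le_mul ?_ (max_le h1 h2) (norm_nonneg _) (by positivity)
    refine shell_decay ha hz hu hu ?_
    have := hC 1 (by norm_num) (u • z.1) (u • z.2)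
    rwa [norm_iteratedFDeriv_one] at this
  refine boundedOnLebesgue_of_cells (ι := ℝ) (T := E) (n := n) hs (C := C' + 4 * (c + c))
    (fun t _ => continuous_dilate hmc t t)
    (fun t _ => ⟨C, fun z => IsAdmissibleMultiplier.norm_le ha (hC 0 (by norm_num)) _⟩) ?_
  intro j
  obtain ⟨S, hS, hSE⟩ := hC' j
  refine ⟨S, hS.trans (by gcongr; exact_mod_cast le_self_add), fun f g hf hfc hg hgc => ?_⟩
  have hF := integrable_fourier_of_contDiff hf hfc
  have hG := integrable_fourier_of_contDiff hg hgc
  have hFc := fourier_continuous (integrable_of_contDiff hf hfc)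
  have hGc := fourier_continuous (integrable_of_contDiff hg hgc)
  obtain ⟨hpt, hav, -⟩ := hc j f g hf hfc hg hgc
  have hm1 : ∀ b : ℝ, Measurable fun x => ‖bilinearMultiplier
      ((dyadicShell d j).indicator (n (cellStart b))) f g x‖ₑ := by
    intro b
    refine (continuous_bilinearMultiplier hF hG (C := C) ((continuous_dilate hmc _ _).measurable.indicator
      (measurableSet_dyadicShell j)).aestronglyMeasurable fun z => ?_).enorm.measurable
    exact (norm_indicator_le_norm_self _ _).trans
      (IsAdmissibleMultiplier.norm_le ha (hC 0 (by norm_num)) _)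
  refine ⟨fun b x => ‖bilinearMultiplier ((dyadicShell d j).indicator (n (cellStart b))) f g x‖ₑ +
    ∫⁻ u in cell b ((1 / 2) ^ j), ‖bilinearMultiplier ((dyadicShell d j).indicator (n' u)) f g x‖ₑ,
    fun b => (hm1 b).add (measurable_lintegral_bilinearMultiplier hFc hGc hn'c.measurable),
    fun b _ => ?_, fun t ht => ?_⟩
  · refine (lintegral_add_sq_le (hm1 b)
      (hpt _ (continuous_dilate hmc _ _).measurable fun z hz => hbn j z hz _ (cellStart_mem b))
      (hav n' hn'c.measurable b fun u hu z hz => hbn' j z hz u hu)).trans ?_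
    set X := ENNReal.ofReal (2 ^ ((d * (2 / p + 2 / q - 1) - 2 * a) * j))
    set N := eLpNorm f (ENNReal.ofReal p) volume ^ 2 * eLpNorm g (ENNReal.ofReal q) volume ^ 2
    calc _ = ((4 * (c + c) : ℝ≥0) : ℝ≥0∞) * X * N := by push_cast; ring
      _ ≤ _ := by gcongr; exact le_add_self
  · obtain ⟨b, hb, htb⟩ := mem_iUnion₂.1 (hSE ht)
    refine ⟨b, hb, fun x => ?_⟩
    refine (enorm_bilinearMultiplier_indicator_le hF hG (measurableSet_dyadicShell j) (n := n)
      (n' := n') (fun u => continuous_dilate hmc u u) hn'c (cellStart_le (hE ht) htb)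
      (C := C * (2 ^ j : ℝ) ^ (-a) * 2 ^ (j + 1)) (fun z u => hasDerivAt_dilate hmd z u)
      (fun z hz => (hbn j z hz _ (cellStart_mem b)).trans
        (le_mul_of_one_le_right (by positivity) (one_le_pow₀ one_le_two)))
      (fun u hu z hz => hbn' j z hz u (Icc_cellStart_subset (hE ht) hu)) x).trans ?_
    exact add_le_add le_rfl (lintegral_mono_set (Ioc_subset_cell (hE ht) htb))

/-- Applying the fundamental theorem in each parameter gives four terms: a corner value, one
integral along each edge and an area integral of the mixed derivative. The last needs two
derivatives of `m`; its loss `~ 2^(2j)` is matched by the cell area. -/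
theorem boundedOnLebesgue_biparameterMaximal {m : V × V → ℂ} {a : ℝ}
    (hm : IsAdmissibleMultiplier m a 2) {E₁ E₂ : Set ℝ} (hE₁ : E₁ ⊆ Icc 1 2) (hE₂ : E₂ ⊆ Icc 1 2)
    {γ₁ γ₂ : ℝ} (hγ₁ : upperMinkowskiDim E₁ < γ₁) (hγ₂ : upperMinkowskiDim E₂ < γ₂) {p q : ℝ}
    (hp : 1 ≤ p) (hp2 : p ≤ 2) (hq : 1 ≤ q) (hq2 : q ≤ 2)
    (hs : γ₁ + γ₂ + (d * (2 / p + 2 / q - 1) - 2 * a) < 0) :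
    BoundedOnLebesgue (biparameterMaximal m E₁ E₂) p q 2 := by
  have ha : 0 ≤ a := (by positivity : (0 : ℝ) ≤ d / 2).trans hm.half_dim_lt.le
  obtain ⟨C, hC⟩ := hm.exists_uniform_decay
  obtain ⟨c, hc⟩ := exists_shell_bounds (d := d) a C hp hp2 hq hq2
  obtain ⟨C₁, hC₁⟩ := exists_dyadic_covers hE₁ hγ₁
  obtain ⟨C₂, hC₂⟩ := exists_dyadic_covers hE₂ hγ₂
  have hmc : Continuous m := hm.contDiff.continuous
  have hmd : Differentiable ℝ m := hm.contDiff.differentiable (by norm_num)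
  have hf1 : ContDiff ℝ 1 (fderiv ℝ m) := hm.contDiff.fderiv_right (by norm_num)
  have hfd : Continuous (fderiv ℝ m) := hf1.continuous
  have hfdd : Differentiable ℝ (fderiv ℝ m) := hf1.differentiable (by norm_num)
  have hfd2 : Continuous (fderiv ℝ (fderiv ℝ m)) := hf1.continuous_fderiv (by norm_num)
  set n : ℝ → ℝ → V × V → ℂ := fun u v z => m (u • z.1, v • z.2) with hn
  set n₁ : ℝ → ℝ → V × V → ℂ := fun u v z => fderiv ℝ m (u • z.1, v • z.2) (z.1, 0) with hn₁
  set n₂ : ℝ → ℝ → V × V → ℂ := fun u v z => fderiv ℝ m (u • z.1, v • z.2) (0, z.2) with hn₂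
  set n₁₂ : ℝ → ℝ → V × V → ℂ :=
    fun u v z => fderiv ℝ (fderiv ℝ m) (u • z.1, v • z.2) (0, z.2) (z.1, 0) with hn₁₂
  have hn₁c : Continuous fun w : (ℝ × ℝ) × (V × V) => n₁ w.1.1 w.1.2 w.2 :=
    (hfd.comp (by fun_prop)).clm_apply (by fun_prop)
  have hn₂c : Continuous fun w : (ℝ × ℝ) × (V × V) => n₂ w.1.1 w.1.2 w.2 :=
    (hfd.comp (by fun_prop)).clm_apply (by fun_prop)
  have hn₁₂c : Continuous fun w : (ℝ × ℝ) × (V × V) => n₁₂ w.1.1 w.1.2 w.2 :=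
    ((hfd2.comp (by fun_prop)).clm_apply (by fun_prop)).clm_apply (by fun_prop)
  have hbn : ∀ j, ∀ z ∈ dyadicShell d j, ∀ u ∈ Icc (1 : ℝ) 2, ∀ v ∈ Icc (1 : ℝ) 2,
      ‖n u v z‖ ≤ C * (2 ^ j : ℝ) ^ (-a) := by
    intro j z hz u hu v hv
    refine shell_decay ha hz hu hv ?_
    have := hC 0 (by norm_num) (u • z.1) (v • z.2)
    rwa [norm_iteratedFDeriv_zero] at this
  have hbf : ∀ j, ∀ z ∈ dyadicShell d j, ∀ u ∈ Icc (1 : ℝ) 2, ∀ v ∈ Icc (1 : ℝ) 2,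
      ‖fderiv ℝ m (u • z.1, v • z.2)‖ ≤ C * (2 ^ j : ℝ) ^ (-a) := by
    intro j z hz u hu v hv
    refine shell_decay ha hz hu hv ?_
    have := hC 1 (by norm_num) (u • z.1) (v • z.2)
    rwa [norm_iteratedFDeriv_one] at this
  have hz1 : ∀ j, ∀ z ∈ dyadicShell d j, ‖((z.1, 0) : V × V)‖ ≤ 2 ^ (j + 1) := fun j z hz =>
    max_le (norm_le_of_mem_dyadicShell hz).1 (by rw [norm_zero]; positivity)
  have hz2 : ∀ j, ∀ z ∈ dyadicShell d j, ‖((0, z.2) : V × V)‖ ≤ 2 ^ (j + 1) := fun j z hz =>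
    max_le (by rw [norm_zero]; positivity) (norm_le_of_mem_dyadicShell hz).2
  have hbn₁ : ∀ j, ∀ z ∈ dyadicShell d j, ∀ u ∈ Icc (1 : ℝ) 2, ∀ v ∈ Icc (1 : ℝ) 2,
      ‖n₁ u v z‖ ≤ C * (2 ^ j : ℝ) ^ (-a) * 2 ^ (j + 1) := fun j z hz u hu v hv =>
    (ContinuousLinearMap.le_opNorm _ _).trans
      (mul_le_mul (hbf j z hz u hu v hv) (hz1 j z hz) (norm_nonneg _) (by positivity))
  have hbn₂ : ∀ j, ∀ z ∈ dyadicShell d j, ∀ u ∈ Icc (1 : ℝ) 2, ∀ v ∈ Icc (1 : ℝ) 2,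
      ‖n₂ u v z‖ ≤ C * (2 ^ j : ℝ) ^ (-a) * 2 ^ (j + 1) := fun j z hz u hu v hv =>
    (ContinuousLinearMap.le_opNorm _ _).trans
      (mul_le_mul (hbf j z hz u hu v hv) (hz2 j z hz) (norm_nonneg _) (by positivity))
  have hbn₁₂ : ∀ j, ∀ z ∈ dyadicShell d j, ∀ u ∈ Icc (1 : ℝ) 2, ∀ v ∈ Icc (1 : ℝ) 2,
      ‖n₁₂ u v z‖ ≤ C * (2 ^ j : ℝ) ^ (-a) * (2 ^ (j + 1) * 2 ^ (j + 1)) := by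
    intro j z hz u hu v hv
    -- Reads the mixed derivative off the second iterated derivative, where the decay hypothesis is
    -- stated.
    have h2 : n₁₂ u v z =
        iteratedFDeriv ℝ 2 m (u • z.1, v • z.2) ![((0, z.2) : V × V), (z.1, 0)] := by
      rw [iteratedFDeriv_two_apply]; rfl
    rw [h2]
    refine (ContinuousMultilinearMap.le_opNorm _ _).trans ?_
    rw [Fin.prod_univ_two]
    refine mul_le_mul (shell_decay ha hz hu hv (hC 2 le_rfl (u • z.1) (v • z.2)))
      (mul_le_mul (hz2 j z hz) (hz1 j z hz) (norm_nonneg _) (by positivity))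
      (mul_nonneg (norm_nonneg _) (norm_nonneg _)) (by positivity)
  have hset : biparameterMaximal m E₁ E₂ = fun f g (x : V) =>
      ⨆ t ∈ E₁ ×ˢ E₂, ‖bilinearMultiplier (n t.1 t.2) f g x‖ₑ := by
    ext f g x
    rw [biparameterMaximal, biSup_prod]
  rw [hset]
  refine boundedOnLebesgue_of_cells (ι := ℝ × ℝ) (T := E₁ ×ˢ E₂) (n := fun t => n t.1 t.2) hs
    (C := C₁ * C₂ + 4 * (4 * (c + c) + 4 * (c + c)))
    (fun t _ => continuous_dilate hmc t.1 t.2)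
    (fun t _ => ⟨C, fun z => IsAdmissibleMultiplier.norm_le ha (hC 0 (by norm_num)) _⟩) ?_
  intro j
  obtain ⟨S₁, hS₁, hSE₁⟩ := hC₁ j
  obtain ⟨S₂, hS₂, hSE₂⟩ := hC₂ j
  refine ⟨S₁ ×ˢ S₂, ?_, fun f g hf hfc hg hgc => ?_⟩
  · rw [Finset.card_product, Nat.cast_mul, add_mul, Real.rpow_add zero_lt_two,
      ENNReal.ofReal_mul (by positivity)]
    calc _ ≤ _ := mul_le_mul' hS₁ hS₂
      _ = ((C₁ * C₂ : ℝ≥0) : ℝ≥0∞) * (ENNReal.ofReal (2 ^ (γ₁ * j)) *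
          ENNReal.ofReal (2 ^ (γ₂ * j))) := by push_cast; ring
      _ ≤ _ := by gcongr; exact le_self_add
  have hF := integrable_fourier_of_contDiff hf hfc
  have hG := integrable_fourier_of_contDiff hg hgc
  have hFc := fourier_continuous (integrable_of_contDiff hf hfc)
  have hGc := fourier_continuous (integrable_of_contDiff hg hgc)
  obtain ⟨hpt, hav, hav2⟩ := hc j f g hf hfc hg hgc
  set A := dyadicShell d j with hA
  have hAm : MeasurableSet A := measurableSet_dyadicShell j
  set h : ℝ := (1 / 2) ^ j with hh
  set Φ₀ : ℝ × ℝ → V → ℝ≥0∞ := fun b x =>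
    ‖bilinearMultiplier (A.indicator (n (cellStart b.1) (cellStart b.2))) f g x‖ₑ with hΦ₀
  set Φ₂ : ℝ × ℝ → V → ℝ≥0∞ := fun b x => ∫⁻ v in cell b.2 h,
    ‖bilinearMultiplier (A.indicator (n₂ (cellStart b.1) v)) f g x‖ₑ with hΦ₂
  set Φ₁ : ℝ × ℝ → V → ℝ≥0∞ := fun b x => ∫⁻ u in cell b.1 h,
    ‖bilinearMultiplier (A.indicator (n₁ u (cellStart b.2))) f g x‖ₑ with hΦ₁
  set Φ₁₂ : ℝ × ℝ → V → ℝ≥0∞ := fun b x => ∫⁻ w : ℝ × ℝ,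
    ‖bilinearMultiplier (A.indicator (n₁₂ w.1 w.2)) f g x‖ₑ
      ∂((volume.restrict (cell b.1 h)).prod (volume.restrict (cell b.2 h))) with hΦ₁₂
  have c₂ : ∀ u, Continuous (Function.uncurry (n₂ u)) := fun u =>
    hn₂c.comp (f := fun w : ℝ × (V × V) => ((u, w.1), w.2)) (by fun_prop)
  have c₁ : ∀ v, Continuous (Function.uncurry fun u => n₁ u v) := fun v =>
    hn₁c.comp (f := fun w : ℝ × (V × V) => ((w.1, v), w.2)) (by fun_prop)
  have c₁₂ : ∀ u, Continuous (Function.uncurry (n₁₂ u)) := fun u =>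
    hn₁₂c.comp (f := fun w : ℝ × (V × V) => ((u, w.1), w.2)) (by fun_prop)
  have cs₁ : ∀ u v, Continuous (n₁ u v) := fun u v =>
    hn₁c.comp (f := fun z : V × V => ((u, v), z)) (by fun_prop)
  have m₀ : ∀ b, Measurable (Φ₀ b) := by
    intro b
    refine (continuous_bilinearMultiplier hF hG (C := C)
      ((continuous_dilate hmc _ _).measurable.indicator hAm).aestronglyMeasurable
      fun z => ?_).enorm.measurable
    exact (norm_indicator_le_norm_self _ _).trans
      (IsAdmissibleMultiplier.norm_le ha (hC 0 (by norm_num)) _)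
  have m₂ : ∀ b, Measurable (Φ₂ b) := fun b =>
    measurable_lintegral_bilinearMultiplier hFc hGc (c₂ _).measurable
  have m₁ : ∀ b, Measurable (Φ₁ b) := fun b =>
    measurable_lintegral_bilinearMultiplier hFc hGc (c₁ _).measurable
  have m₁₂ : ∀ b, Measurable (Φ₁₂ b) := fun b =>
    measurable_lintegral_bilinearMultiplier (n := fun w : ℝ × ℝ => n₁₂ w.1 w.2) hFc hGc
      hn₁₂c.measurable
  refine ⟨fun b x => (Φ₀ b x + Φ₂ b x) + (Φ₁ b x + Φ₁₂ b x),
    fun b => ((m₀ b).add (m₂ b)).add ((m₁ b).add (m₁₂ b)), fun b _ => ?_, fun t ht => ?_⟩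
  · refine (lintegral_add_sq_le ((m₀ b).add (m₂ b))
      (lintegral_add_sq_le (m₀ b)
        (hpt _ (continuous_dilate hmc _ _).measurable fun z hz =>
          hbn j z hz _ (cellStart_mem b.1) _ (cellStart_mem b.2))
        (hav (n₂ (cellStart b.1)) (c₂ _).measurable b.2 fun v hv z hz =>
          hbn₂ j z hz _ (cellStart_mem b.1) v hv))
      (lintegral_add_sq_le (m₁ b)
        (hav (fun u => n₁ u (cellStart b.2)) (c₁ _).measurable b.1 fun u hu z hz =>
          hbn₁ j z hz u hu _ (cellStart_mem b.2))
        (hav2 n₁₂ hn₁₂c.measurable b.1 b.2 fun u hu v hv z hz =>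
          hbn₁₂ j z hz u hu v hv))).trans ?_
    set X := ENNReal.ofReal (2 ^ ((d * (2 / p + 2 / q - 1) - 2 * a) * j))
    set N := eLpNorm f (ENNReal.ofReal p) volume ^ 2 * eLpNorm g (ENNReal.ofReal q) volume ^ 2
    calc _ = ((4 * (4 * (c + c) + 4 * (c + c)) : ℝ≥0) : ℝ≥0∞) * X * N := by push_cast; ring
      _ ≤ _ := by gcongr; exact le_add_self
  · obtain ⟨b₁, hb₁, htb₁⟩ := mem_iUnion₂.1 (hSE₁ ht.1)
    obtain ⟨b₂, hb₂, htb₂⟩ := mem_iUnion₂.1 (hSE₂ ht.2)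
    refine ⟨(b₁, b₂), Finset.mem_product.2 ⟨hb₁, hb₂⟩, fun x => ?_⟩
    have ht₁ := hE₁ ht.1
    have ht₂ := hE₂ ht.2
    have one_le : (1 : ℝ) ≤ 2 ^ (j + 1) := one_le_pow₀ one_le_two
    -- Moves `t₁` to the corner with `t₂` still free; the next two steps move `t₂`, in the boundary
    -- term and in the integrand respectively.
    have step₁ := enorm_bilinearMultiplier_indicator_le hF hG hAm (n := fun u => n u t.2)
      (n' := fun u => n₁ u t.2) (fun u => continuous_dilate hmc u t.2) (c₁ _)
      (cellStart_le ht₁ htb₁) (C := C * (2 ^ j : ℝ) ^ (-a) * 2 ^ (j + 1))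
      (fun z u => hasDerivAt_dilate_fst hmd z u t.2)
      (fun z hz => (hbn j z hz _ (cellStart_mem b₁) _ ht₂).trans
        (le_mul_of_one_le_right (by positivity) one_le))
      (fun u hu z hz => hbn₁ j z hz u (Icc_cellStart_subset ht₁ hu) _ ht₂) x
    have step₂ := enorm_bilinearMultiplier_indicator_le hF hG hAm (n := n (cellStart b₁))
      (n' := n₂ (cellStart b₁)) (fun v => continuous_dilate hmc _ v) (c₂ _)
      (cellStart_le ht₂ htb₂) (C := C * (2 ^ j : ℝ) ^ (-a) * 2 ^ (j + 1))
      (fun z v => hasDerivAt_dilate_snd hmd z _ v)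
      (fun z hz => (hbn j z hz _ (cellStart_mem b₁) _ (cellStart_mem b₂)).trans
        (le_mul_of_one_le_right (by positivity) one_le))
      (fun v hv z hz => hbn₂ j z hz _ (cellStart_mem b₁) v (Icc_cellStart_subset ht₂ hv)) x
    have step₃ : ∀ u ∈ Icc (1 : ℝ) 2, ‖bilinearMultiplier (A.indicator (n₁ u t.2)) f g x‖ₑ ≤
        ‖bilinearMultiplier (A.indicator (n₁ u (cellStart b₂))) f g x‖ₑ +
          ∫⁻ v in cell b₂ h, ‖bilinearMultiplier (A.indicator (n₁₂ u v)) f g x‖ₑ := by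
      intro u hu
      refine (enorm_bilinearMultiplier_indicator_le hF hG hAm (n := n₁ u)
        (n' := n₁₂ u) (fun v => cs₁ u v) (c₁₂ _)
        (cellStart_le ht₂ htb₂) (C := C * (2 ^ j : ℝ) ^ (-a) * (2 ^ (j + 1) * 2 ^ (j + 1)))
        (fun z v => ?_)
        (fun z hz => (hbn₁ j z hz _ hu _ (cellStart_mem b₂)).trans ?_)
        (fun v hv z hz => hbn₁₂ j z hz _ hu v (Icc_cellStart_subset ht₂ hv)) x).trans ?_
      · simpa using! (hasDerivAt_dilate_snd hfdd z u v).clm_apply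
          (hasDerivAt_const v ((z.1, 0) : V × V))
      · exact mul_le_mul_of_nonneg_left (le_mul_of_one_le_right (by positivity) one_le)
          (by positivity)
      · gcongr
        exact Ioc_subset_cell ht₂ htb₂
    have hmeas₁ : Measurable fun u =>
        ‖bilinearMultiplier (A.indicator (n₁ u (cellStart b₂))) f g x‖ₑ :=
      ((measurable_bilinearMultiplier_param (measurable_indicator_param hAm (c₁ _).measurable)
        hFc hGc).comp measurable_prodMk_left).enorm
    have hmeas₁₂ : Measurable fun w : ℝ × ℝ =>
        ‖bilinearMultiplier (A.indicator (n₁₂ w.1 w.2)) f g x‖ₑ :=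
      ((measurable_bilinearMultiplier_param (measurable_indicator_param hAm
        (n := fun w : ℝ × ℝ => n₁₂ w.1 w.2) hn₁₂c.measurable)
        hFc hGc).comp measurable_prodMk_left).enorm
    calc _ ≤ _ := step₁
      _ ≤ (Φ₀ (b₁, b₂) x + Φ₂ (b₁, b₂) x) + ∫⁻ u in cell b₁ h,
          (‖bilinearMultiplier (A.indicator (n₁ u (cellStart b₂))) f g x‖ₑ +
          ∫⁻ v in cell b₂ h, ‖bilinearMultiplier (A.indicator (n₁₂ u v)) f g x‖ₑ) := by
          refine add_le_add (step₂.trans ?_) ?_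
          · simp only [hΦ₀, hΦ₂]
            gcongr
            exact Ioc_subset_cell ht₂ htb₂
          · refine (lintegral_mono_set (Ioc_subset_cell ht₁ htb₁)).trans ?_
            exact setLIntegral_mono' (measurableSet_cell _ _) fun u hu =>
              step₃ u (cell_subset _ _ hu)
      _ = _ := by
          rw [lintegral_add_left hmeas₁]
          simp only [hΦ₁, hΦ₁₂]
          rw [lintegral_prod _ hmeas₁₂.aemeasurable]

end Maximal

/-! ### Exponent arithmetic and conclusion. -/

theorem exponent_lt {d a β p q : ℝ} (hd : 0 < d)
    (h : 1 / p + 1 / q < 1 / 2 + (2 * a - β) / (2 * d)) :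
    β + (d * (2 / p + 2 / q - 1) - 2 * a) < 0 := by
  have h1 := mul_lt_mul_of_pos_left h (by linarith : 0 < 2 * d)
  have h2 : 2 * d * (1 / 2 + (2 * a - β) / (2 * d)) = d + (2 * a - β) := by field_simp
  have h3 : d * (2 / p + 2 / q - 1) = 2 * d * (1 / p + 1 / q) - d := by ring
  linarith

theorem proposition6p2 (d : ℕ) (hd : 1 ≤ d)
    (m : EuclideanSpace ℝ (Fin d) × EuclideanSpace ℝ (Fin d) → ℂ) (a : ℝ) :
    (∀ (E : Set ℝ) (β : ℝ), E ⊆ Icc 1 2 → E.Nonempty → upperMinkowskiDim E = β →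
      IsAdmissibleMultiplier m a 1 → d + β < 2 * a →
        (2 * a ≤ 2 * d + β → ∀ p q : ℝ,
          2 * d / (2 * a - β) < p → p ≤ 2 → 2 * d / (2 * a - β) < q → q ≤ 2 →
          1 / p + 1 / q < 1 / 2 + (2 * a - β) / (2 * d) →
            BoundedOnLebesgue (singleScaleMaximal m E) p q 2) ∧
        (2 * d + β < 2 * a → ∀ p q : ℝ,
          1 < p → p ≤ 2 → 1 < q → q ≤ 2 → 1 / p + 1 / q < 3 / 2 →
            BoundedOnLebesgue (singleScaleMaximal m E) p q 2)) ∧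
    (∀ (E₁ E₂ : Set ℝ) (β₁ β₂ : ℝ), E₁ ⊆ Icc 1 2 → E₁.Nonempty → E₂ ⊆ Icc 1 2 → E₂.Nonempty →
      upperMinkowskiDim E₁ = β₁ → upperMinkowskiDim E₂ = β₂ →
      IsAdmissibleMultiplier m a 2 → d + β₁ + β₂ < 2 * a →
        (2 * a ≤ 2 * d + β₁ + β₂ → ∀ p q : ℝ,
          2 * d / (2 * a - β₁ - β₂) < p → p ≤ 2 → 2 * d / (2 * a - β₁ - β₂) < q → q ≤ 2 →
          1 / p + 1 / q < 1 / 2 + (2 * a - β₁ - β₂) / (2 * d) →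
            BoundedOnLebesgue (biparameterMaximal m E₁ E₂) p q 2) ∧
        (2 * d + β₁ + β₂ < 2 * a → ∀ p q : ℝ,
          1 < p → p ≤ 2 → 1 < q → q ≤ 2 → 1 / p + 1 / q < 3 / 2 →
            BoundedOnLebesgue (biparameterMaximal m E₁ E₂) p q 2)) := by

  have hd0 : (0 : ℝ) < d := by exact_mod_cast hd
  have hd1 : (1 : ℝ) ≤ d := by exact_mod_cast hd
  -- The lower bound on `p` and `q` enters only by forcing them to be at least one, the range of
  -- Bernstein's inequality.
  have hcrit : ∀ {b p : ℝ}, d < b → b ≤ 2 * d → 2 * d / b < p → 1 ≤ p := by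
    intro b p h1 h2 h3
    have : 1 ≤ 2 * d / b := by rw [le_div_iff₀ (by linarith)]; linarith
    linarith
  -- Once `b > 2d`, the general threshold exceeds `3/2`, so the second regime reduces to the same
  -- estimate.
  have hlarge : ∀ {b p q : ℝ}, 2 * d < b → 1 / p + 1 / q < 3 / 2 →
      1 / p + 1 / q < 1 / 2 + b / (2 * d) := by
    intro b p q h1 h2
    have : 1 < b / (2 * d) := by rw [lt_div_iff₀ (by linarith)]; linarith
    linarith
  refine ⟨fun E β hE _ hβ hm hlt => ?_, fun E₁ E₂ β₁ β₂ hE₁ _ hE₂ _ hβ₁ hβ₂ hm hlt => ?_⟩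
  · have main : ∀ {p q : ℝ}, 1 ≤ p → p ≤ 2 → 1 ≤ q → q ≤ 2 →
        1 / p + 1 / q < 1 / 2 + (2 * a - β) / (2 * d) →
        BoundedOnLebesgue (singleScaleMaximal m E) p q 2 := by
      intro p q hp hp2 hq hq2 h
      have hneg := exponent_lt hd0 h
      -- Half the slack goes into `γ = β + ε`, leaving total exponent `-ε`.
      set ε := -(β + (d * (2 / p + 2 / q - 1) - 2 * a)) / 2 with hε
      exact boundedOnLebesgue_singleScaleMaximal hm hE (γ := β + ε) (by linarith) hp hp2 hq hq2
        (by linarith)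
    exact ⟨fun hle p q hp hp2 hq hq2 h => main (hcrit (by linarith) (by linarith) hp) hp2
      (hcrit (by linarith) (by linarith) hq) hq2 h,
      fun hgt p q hp hp2 hq hq2 h => main hp.le hp2 hq.le hq2 (hlarge (by linarith) h)⟩
  · have main : ∀ {p q : ℝ}, 1 ≤ p → p ≤ 2 → 1 ≤ q → q ≤ 2 →
        1 / p + 1 / q < 1 / 2 + (2 * a - β₁ - β₂) / (2 * d) →
        BoundedOnLebesgue (biparameterMaximal m E₁ E₂) p q 2 := by
      intro p q hp hp2 hq hq2 h
      rw [sub_sub] at h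
      have hneg := exponent_lt hd0 h
      -- A quarter of the slack for each dimension leaves total exponent `-2ε`.
      set ε := -(β₁ + β₂ + (d * (2 / p + 2 / q - 1) - 2 * a)) / 4 with hε
      exact boundedOnLebesgue_biparameterMaximal hm hE₁ hE₂ (γ₁ := β₁ + ε) (γ₂ := β₂ + ε)
        (by linarith) (by linarith) hp hp2 hq hq2 (by linarith)
    exact ⟨fun hle p q hp hp2 hq hq2 h => main (hcrit (by linarith) (by linarith) hp) hp2
      (hcrit (by linarith) (by linarith) hq) hq2 h,
      fun hgt p q hp hp2 hq hq2 h => main hp.le hp2 hq.le hq2 (hlarge (by linarith) h)⟩
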